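/- Work in the meridional plane with coordinates $(r,z)$ and put $\mathbb{R}^2_+=\{r>0\}$, $\nabla=(\partial_r,\partial_z)$, $\operatorname{div}$ being the divergence in $(r,z)$. Let $\sigma,\rho>0$ be the surface tension and the density. Let $E$ be a bounded convex set with nonempty interior, symmetric under $z\mapsto -z$, with $\overline E\subset\mathbb{R}^2_+$ and $\partial E$ of class $C^2$; let $n$ be its outer unit normal, $\kappa\ge 0$ the curvature of the curve $\partial E$, $H=\kappa+\frac{n\cdot e_r}{r}$, $|E|$ the area of $E$. A solution is a tuple $(E,\psi,W,\gamma,\lambda)$ with such an $E$, real constants $W,\gamma,\lambda$, and a function $\psi$ that is $C^2$ in $\mathbb{R}^2_+\setminus\overline E$, $C^1$ up to $\partial E$ and continuous up to $\{r=0\}$, such that \[ \begin{aligned} -\operatorname{div}\Big(\frac1r\nabla\psi\Big)&=0 &&\text{in }\mathbb{R}^2_+\setminus\overline E,\\ \psi-\frac W2 r^2&=\gamma &&\text{on }\partial E,\\ 2\sigma H-\rho\Big(\frac1r\partial_n\psi-W\,n\cdot e_r\Big)^2+\lambda&=0 &&\text{on }\partial E,\\ \psi&=0 &&\text{on }\{r=0\},\\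 \psi&\to0 &&\text{as }|(r,z)|\to\infty . \end{aligned} \] Define \[ \beta=-\int_{\partial E}\frac1r\partial_n\psi\,ds,\quad \mathrm{We}=\frac{\sqrt{2\pi}\,\rho\,\beta^2}{\sigma\sqrt{|E|}},\quad R=\frac1{|E|}\int_E r\,d(r,z),\quad \mu=\frac{R}{\sqrt{|E|}},\quad \delta=\int_E\frac1{r^2}\,d(r,z)-2\pi,\quad \Psi=\psi-\frac W2r^2 . \] **Theorem 1.** There exists a constant $C>0$ (independent of $\sigma$, $\rho$ and of the solution) such that every solution $(E,\psi,W,\gamma,\lambda)$ satisfying the thick-ring condition $\int_{\partial E}H\,ds\le0$ and the maximum principle $\partial_n\Psi\le0$ on $\partial E$ fulfils \[ \mathrm{We}\ \ge\ \frac{C}{\mu+\mu^3}\left(\frac1{\mu^2}+\delta\right). \] -/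

import Mathlib

open Set Filter Topology MeasureTheory

noncomputable section

namespace BubbleRing

/-! Points of the meridional plane are pairs `(r, z) : ℝ × ℝ`. -/

/-- The open meridional half plane `{(r, z) : r > 0}`. -/
def halfPlane : Set (ℝ × ℝ) := {p | 0 < p.1}

/-- The partial derivative `∂_r f`. -/
def partialR (f : ℝ × ℝ → ℝ) (p : ℝ × ℝ) : ℝ := fderiv ℝ f p (1, 0)

/-- The partial derivative `∂_z f`. -/
def partialZ (f : ℝ × ℝ → ℝ) (p : ℝ × ℝ) : ℝ := fderiv ℝ f p (0, 1)

/-- The operator `div ((1/r) ∇ψ)`, with `div` and `∇` taken in the variables `(r, z)`. -/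
def divGradOverR (ψ : ℝ × ℝ → ℝ) (p : ℝ × ℝ) : ℝ :=
  partialR (fun q => 1 / q.1 * partialR ψ q) p + partialZ (fun q => 1 / q.1 * partialZ ψ q) p

/-! ### The boundary curve -/

/-- The normal `(z', -r')` of an arc-length curve `c = (r, z)`. -/
def normal (c : ℝ → ℝ × ℝ) (s : ℝ) : ℝ × ℝ := ((deriv c s).2, -(deriv c s).1)

/-- The curvature `r' z'' - z' r''` of an arc-length curve `c = (r, z)`; it is positive for a
counterclockwise circle. -/
def curvature (c : ℝ → ℝ × ℝ) (s : ℝ) : ℝ :=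
  (deriv c s).1 * (deriv (deriv c) s).2 - (deriv c s).2 * (deriv (deriv c) s).1

/-- `H = κ + (n · e_r) / r`. -/
def meanCurvature (c : ℝ → ℝ × ℝ) (s : ℝ) : ℝ :=
  curvature c s + (normal c s).1 / (c s).1

/-- `c` is an arc-length parametrisation of class `C²` and of period `L` of the boundary of `E`,
a simple closed curve, oriented so that `normal c` points to the exterior of `E`. -/
structure IsBoundaryParam (E : Set (ℝ × ℝ)) (c : ℝ → ℝ × ℝ) (L : ℝ) : Prop where
  length_pos : 0 < L
  contDiff : ContDiff ℝ 2 c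
  periodic : Function.Periodic c L
  unit_speed : ∀ s, (deriv c s).1 ^ 2 + (deriv c s).2 ^ 2 = 1
  injOn : InjOn c (Ico 0 L)
  image_eq : c '' Ico 0 L = frontier E
  outward : ∀ s, ∀ᶠ t in 𝓝[>] (0 : ℝ), c s + t • normal c s ∉ closure E

/-- The integral `∫_{∂E} f ds`, for `f` given as a function of arc length along a boundary of
length `L`. -/
def boundaryIntegral (L : ℝ) (f : ℝ → ℝ) : ℝ := ∫ s in (0 : ℝ)..L, f s

/-- The normal derivative `∂_n f` at the boundary point `c s`, taken from the exterior:
the right derivative at `t = 0` of `t ↦ f (c s + t n)`. -/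
def normalDeriv (c : ℝ → ℝ × ℝ) (f : ℝ × ℝ → ℝ) (s : ℝ) : ℝ :=
  derivWithin (fun t : ℝ => f (c s + t • normal c s)) (Ici 0) 0

/-! ### Cross-sections -/

/-- A cross-section of a toroidal bubble: a bounded convex set with nonempty interior, symmetric
in `z`, whose closure lies in the open half plane. -/
structure IsCrossSection (E : Set (ℝ × ℝ)) : Prop where
  convex : Convex ℝ E
  symmetric : ∀ r z : ℝ, (r, z) ∈ E → (r, -z) ∈ E
  bounded : Bornology.IsBounded E
  interior_nonempty : (interior E).Nonempty
  closure_subset : closure E ⊆ halfPlane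

/-- The area `|E|`. -/
def area (E : Set (ℝ × ℝ)) : ℝ := volume.real E

/-- The major radius `R = |E|⁻¹ ∫_E r d(r,z)`. -/
def majorRadius (E : Set (ℝ × ℝ)) : ℝ := 1 / area E * ∫ p in E, p.1

/-- `μ = R / √|E|`. -/
def aspect (E : Set (ℝ × ℝ)) : ℝ := majorRadius E / √(area E)

/-- `δ = ∫_E r⁻² d(r,z) - 2π`. -/
def thickness (E : Set (ℝ × ℝ)) : ℝ := (∫ p in E, 1 / p.1 ^ 2) - 2 * Real.pi

/-! ### The overdetermined problem -/

/-- Classical solutions `(E, ψ, W, γ, λ)` of the travelling-wave problem for the capillary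
free-boundary Euler equations with surface tension `σ` and density `ρ`, where `∂E` is
parametrised by `c` with length `L`. -/
structure IsSolution (σ ρ : ℝ) (E : Set (ℝ × ℝ)) (c : ℝ → ℝ × ℝ) (L : ℝ)
    (ψ : ℝ × ℝ → ℝ) (W flux lam : ℝ) : Prop where
  crossSection : IsCrossSection E
  boundary : IsBoundaryParam E c L
  /-- `ψ` is `C²` in the fluid domain. -/
  contDiffOn : ContDiffOn ℝ 2 ψ (halfPlane \ closure E)
  /-- `ψ` is `C¹` up to the boundary of the bubble. -/
  contDiffOn_boundary : ContDiffOn ℝ 1 ψ (halfPlane \ interior E)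
  /-- `ψ` is continuous up to the symmetry axis. -/
  continuousOn : ContinuousOn ψ ({p | 0 ≤ p.1} \ interior E)
  elliptic : ∀ p ∈ halfPlane \ closure E, -divGradOverR ψ p = 0
  dirichlet : ∀ s, ψ (c s) - W / 2 * (c s).1 ^ 2 = flux
  bernoulli : ∀ s, 2 * σ * meanCurvature c s
      - ρ * (1 / (c s).1 * normalDeriv c ψ s - W * (normal c s).1) ^ 2 + lam = 0
  axis : ∀ z : ℝ, ψ (0, z) = 0
  decay : Tendsto ψ (Bornology.cobounded (ℝ × ℝ) ⊓ 𝓟 {p | 0 ≤ p.1}) (𝓝 0)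

/-- The stream function in the moving frame, `Ψ = ψ - W r² / 2`. -/
def movingStream (ψ : ℝ × ℝ → ℝ) (W : ℝ) (p : ℝ × ℝ) : ℝ := ψ p - W * p.1 ^ 2 / 2

/-- The circulation `β = -∫_{∂E} (1/r) ∂_n ψ ds`. -/
def circulation (c : ℝ → ℝ × ℝ) (L : ℝ) (ψ : ℝ × ℝ → ℝ) : ℝ :=
  -boundaryIntegral L (fun s => 1 / (c s).1 * normalDeriv c ψ s)

/-- The Weber number `We = √(2π) ρ β² / (σ √|E|)`. -/
def weber (σ ρ : ℝ) (E : Set (ℝ × ℝ)) (c : ℝ → ℝ × ℝ) (L : ℝ) (ψ : ℝ × ℝ → ℝ) : ℝ :=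
  √(2 * Real.pi) * ρ * circulation c L ψ ^ 2 / (σ * √(area E))

end BubbleRing

end

/-! A lower bound for the Weber number of a thick bubble ring.

Parametrise `∂E` by arc length, let `n = (n_r, n_z)` be the outer normal and put
`X = ∫_{∂E} n_r² / r ds` and `v = (1/r) ∂_n Ψ = (1/r) ∂_n ψ - W n_r`. The Bernoulli condition reads
`ρ v² = 2 σ H + λ`, and `v ≤ 0` by assumption. The elliptic equation itself is not needed: the
bound follows from the Bernoulli condition and the geometry of the convex set `E`.

*Lower bound for `λ`.* The total curvature of `∂E` is `2π` and `∫ n_r / r ds = -∫_E r⁻²`, so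
`∫ H ds = -δ`; moreover `∫ κ n ds = 0`, so `∫ H n_r ds = X`. Since `∫ ρ v² n_r ds ≤ ∫ ρ v² ds`, this
gives `2 σ (X + δ) ≤ λ L` (`IsSolution.mul_length_ge`).

*Lower bound for `β`.* As `∫ n_r ds = 0` and `v ≤ 0`, the circulation is `β = ∫ |v| ds`. Where
`n_r ≥ 0`, convexity gives `H ≥ 0` and `ρ v² ≥ λ`. That part of `∂E` has length at least `2h`, with
`h = max z`, so `ρ β² ≥ 4 λ h²` (`IsSolution.circulation_ge`), whence
`We ≥ 8 h² (X + δ) / (L √|E|)` (`IsSolution.weber_ge`).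

*Geometry.* With `b = max r` one has `|E| ≤ 2 b h`, `R ≥ b / 8` and, by Minkowski's formula
`L = ∫ κ c · n ds`, `L ≤ 2π (b + h)`; this converts the factor `h² / (L √|E|)` into
`1 / (μ + μ³)` (`HasExtents.aspect_bound`). It remains to see `X ≳ h / b ≳ 1 / μ²`
(`HasExtents.energy_ge`). For flat sections this needs the thick-ring condition in the form
`-∫ n_r / r ds = ∫_E r⁻² ≥ 2π`: a flat ellipse, say, has only `X ≈ (h / b)²` up to a logarithm,
but is excluded, since a flat section satisfying the condition has to reach close to the axis.

The divergence theorem on `E` and the value `2π` of the total curvature both come from radial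
coordinates `p + t (c s - p)` about an interior point `p`
(`IsBoundaryParam.setIntegral_eq_radial`); these are available because the tangent lines of `∂E`
support `E` (`IsBoundaryParam.support_interior`). -/

noncomputable section

namespace BubbleRing

/-! ### Calculus along the boundary curve -/

section Curve

variable {E : Set (ℝ × ℝ)} {c : ℝ → ℝ × ℝ} {L : ℝ}

namespace IsBoundaryParam

theorem continuous (hb : IsBoundaryParam E c L) : Continuous c := hb.contDiff.continuous

theorem contDiff_deriv (hb : IsBoundaryParam E c L) : ContDiff ℝ 1 (deriv c) :=
  ((contDiff_succ_iff_deriv (n := 1)).1 hb.contDiff).2.2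

theorem continuous_deriv (hb : IsBoundaryParam E c L) : Continuous (deriv c) :=
  hb.contDiff_deriv.continuous

theorem continuous_deriv_deriv (hb : IsBoundaryParam E c L) : Continuous (deriv (deriv c)) :=
  hb.contDiff_deriv.continuous_deriv le_rfl

theorem continuous_fst (hb : IsBoundaryParam E c L) : Continuous fun s => (c s).1 :=
  hb.continuous.fst

theorem continuous_snd (hb : IsBoundaryParam E c L) : Continuous fun s => (c s).2 :=
  hb.continuous.snd

theorem continuous_deriv_fst (hb : IsBoundaryParam E c L) : Continuous fun s => (deriv c s).1 :=
  hb.continuous_deriv.fst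

theorem continuous_deriv_snd (hb : IsBoundaryParam E c L) : Continuous fun s => (deriv c s).2 :=
  hb.continuous_deriv.snd

theorem hasDerivAt (hb : IsBoundaryParam E c L) (s : ℝ) : HasDerivAt c (deriv c s) s :=
  (hb.contDiff.differentiable (by norm_num) s).hasDerivAt

theorem hasDerivAt_fst (hb : IsBoundaryParam E c L) (s : ℝ) :
    HasDerivAt (fun s => (c s).1) (deriv c s).1 s :=
  (ContinuousLinearMap.fst ℝ ℝ ℝ).hasFDerivAt.comp_hasDerivAt s (hb.hasDerivAt s)

theorem hasDerivAt_snd (hb : IsBoundaryParam E c L) (s : ℝ) :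
    HasDerivAt (fun s => (c s).2) (deriv c s).2 s :=
  (ContinuousLinearMap.snd ℝ ℝ ℝ).hasFDerivAt.comp_hasDerivAt s (hb.hasDerivAt s)

theorem hasDerivAt_deriv (hb : IsBoundaryParam E c L) (s : ℝ) :
    HasDerivAt (deriv c) (deriv (deriv c) s) s :=
  (hb.contDiff_deriv.differentiable (by norm_num) s).hasDerivAt

theorem hasDerivAt_deriv_fst (hb : IsBoundaryParam E c L) (s : ℝ) :
    HasDerivAt (fun s => (deriv c s).1) (deriv (deriv c) s).1 s :=
  (ContinuousLinearMap.fst ℝ ℝ ℝ).hasFDerivAt.comp_hasDerivAt s (hb.hasDerivAt_deriv s)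

theorem hasDerivAt_deriv_snd (hb : IsBoundaryParam E c L) (s : ℝ) :
    HasDerivAt (fun s => (deriv c s).2) (deriv (deriv c) s).2 s :=
  (ContinuousLinearMap.snd ℝ ℝ ℝ).hasFDerivAt.comp_hasDerivAt s (hb.hasDerivAt_deriv s)

theorem deriv_inner_deriv_deriv (hb : IsBoundaryParam E c L) (s : ℝ) :
    (deriv c s).1 * (deriv (deriv c) s).1 + (deriv c s).2 * (deriv (deriv c) s).2 = 0 := by
  have h := ((hb.hasDerivAt_deriv_fst s).pow 2).add ((hb.hasDerivAt_deriv_snd s).pow 2)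
  have h' : HasDerivAt (fun _ : ℝ => (1 : ℝ)) 0 s := hasDerivAt_const _ _
  have h2 := h.unique (h'.congr_of_eventuallyEq (Eventually.of_forall fun t => hb.unit_speed t))
  norm_num at h2
  linarith

/-- The Frenet equation `c'' = -κ n`, first component. -/
theorem deriv_deriv_fst (hb : IsBoundaryParam E c L) (s : ℝ) :
    (deriv (deriv c) s).1 = -(curvature c s * (deriv c s).2) := by
  unfold curvature
  linear_combination (-(deriv (deriv c) s).1) * hb.unit_speed s
    + (deriv c s).1 * hb.deriv_inner_deriv_deriv s

/-- The Frenet equation `c'' = -κ n`, second component. -/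
theorem deriv_deriv_snd (hb : IsBoundaryParam E c L) (s : ℝ) :
    (deriv (deriv c) s).2 = curvature c s * (deriv c s).1 := by
  unfold curvature
  linear_combination (-(deriv (deriv c) s).2) * hb.unit_speed s
    + (deriv c s).2 * hb.deriv_inner_deriv_deriv s

theorem continuous_curvature (hb : IsBoundaryParam E c L) : Continuous (curvature c) :=
  (hb.continuous_deriv.fst.mul hb.continuous_deriv_deriv.snd).sub
    (hb.continuous_deriv.snd.mul hb.continuous_deriv_deriv.fst)

theorem periodic_deriv (hb : IsBoundaryParam E c L) : Function.Periodic (deriv c) L := by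
  intro s
  rw [← deriv_comp_add_const]
  congr 1
  exact funext hb.periodic

theorem apply_length (hb : IsBoundaryParam E c L) : c L = c 0 := by
  simpa using hb.periodic 0

theorem deriv_apply_length (hb : IsBoundaryParam E c L) : deriv c L = deriv c 0 := by
  simpa using hb.periodic_deriv 0

theorem mem_frontier (hb : IsBoundaryParam E c L) (s : ℝ) : c s ∈ frontier E := by
  obtain ⟨t, ht, h⟩ := hb.periodic.exists_mem_Ico₀ hb.length_pos s
  rw [h, ← hb.image_eq]
  exact mem_image_of_mem c ht

theorem mem_closure (hb : IsBoundaryParam E c L) (s : ℝ) : c s ∈ closure E :=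
  frontier_subset_closure (hb.mem_frontier s)

theorem notMem_interior (hb : IsBoundaryParam E c L) (s : ℝ) : c s ∉ interior E :=
  (hb.mem_frontier s).2

/-! ### Supporting lines and convexity -/

/-- The tangent line at a boundary point supports `E`, which lies on the side opposite to the
normal. The line separates `interior E` from the ray `c s + t n`; a separating functional attains
its maximum along the curve at `s`, hence is a multiple of `n`, and it is nonnegative on `n`. -/
theorem support_interior (hb : IsBoundaryParam E c L) (hE : Convex ℝ E)
    (hi : (interior E).Nonempty) (s : ℝ) {x : ℝ × ℝ} (hx : x ∈ interior E) :
    (x.1 - (c s).1) * (deriv c s).2 - (x.2 - (c s).2) * (deriv c s).1 < 0 := by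
  set n := normal c s with hn
  have hray : ∀ t : ℝ, 0 < t → c s + t • n ∉ interior E := by
    intro t ht hmem
    obtain ⟨u, hu, hut⟩ := ((hb.outward s).and (Ioo_mem_nhdsGT ht)).exists
    apply hu
    apply interior_subset_closure
    refine hE.openSegment_interior_closure_subset_interior hmem (hb.mem_closure s) ?_
    refine ⟨u / t, 1 - u / t, div_pos hut.1 ht, sub_pos.2 ((div_lt_one ht).2 hut.2), by ring, ?_⟩
    rw [smul_add, smul_smul, div_mul_cancel₀ _ ht.ne']
    module
  set ray : Set (ℝ × ℝ) := (fun t : ℝ => c s + t • n) '' Ioi 0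
  have hrayconv : Convex ℝ ray := by
    rintro _ ⟨t, ht, rfl⟩ _ ⟨u, hu, rfl⟩ α β hα hβ hαβ
    refine ⟨α * t + β * u, ?_, ?_⟩
    · have := convex_Ioi (0 : ℝ) ht hu hα hβ hαβ
      simpa using this
    · have h : c s = α • c s + β • c s := by rw [← add_smul, hαβ, one_smul]
      simp only [smul_add, smul_smul, add_smul]
      nth_rw 1 [h]
      abel
  have hdisj : Disjoint (interior E) ray := by
    rw [Set.disjoint_right]
    rintro _ ⟨t, ht, rfl⟩
    exact hray t ht
  obtain ⟨f, u, hf1, hf2⟩ :=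
    geometric_hahn_banach_open hE.interior isOpen_interior hrayconv hdisj
  have hcl : ∀ y ∈ closure E, f y ≤ u := by
    intro y hy
    rw [← hE.closure_interior_eq_closure_of_nonempty_interior hi] at hy
    exact closure_minimal (fun z hz => (hf1 z hz).le) (isClosed_le f.continuous continuous_const) hy
  have hge : ∀ t : ℝ, 0 < t → u ≤ f (c s) + t * f n := by
    intro t ht
    have := hf2 _ ⟨t, ht, rfl⟩
    simpa using this
  have hcs : f (c s) = u := by
    refine le_antisymm (hcl _ (hb.mem_closure s)) ?_
    have hlim : Tendsto (fun t : ℝ => f (c s) + t * f n) (𝓝[>] 0) (𝓝 (f (c s) + 0 * f n)) :=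
      (Continuous.tendsto (by fun_prop) 0).mono_left nhdsWithin_le_nhds
    rw [zero_mul, add_zero] at hlim
    exact ge_of_tendsto hlim (eventually_nhdsWithin_of_forall hge)
  have hfn : 0 ≤ f n := by have := hge 1 one_pos; linarith
  have hft : f (deriv c s) = 0 := by
    have hmax : IsLocalMax (fun t => f (c t)) s :=
      Eventually.of_forall fun t => by
        change f (c t) ≤ f (c s)
        rw [hcs]; exact hcl _ (hb.mem_closure t)
    exact hmax.hasDerivAt_eq_zero (f.hasFDerivAt.comp_hasDerivAt s (hb.hasDerivAt s))
  have hfx := hf1 x hx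
  have hdec : x - c s = ((x.1 - (c s).1) * (deriv c s).2 - (x.2 - (c s).2) * (deriv c s).1) • n
      + ((x.1 - (c s).1) * (deriv c s).1 + (x.2 - (c s).2) * (deriv c s).2) • deriv c s := by
    ext
    · simp [hn, normal]
      linear_combination (-(x.1 - (c s).1)) * hb.unit_speed s
    · simp [hn, normal]
      linear_combination (-(x.2 - (c s).2)) * hb.unit_speed s
  have hval := congrArg f hdec
  simp only [map_sub, map_add, map_smul, hft, smul_eq_mul, mul_zero, add_zero, hcs] at hval
  by_contra hcon
  have := mul_nonneg (not_lt.1 hcon) hfn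
  linarith

theorem support (hb : IsBoundaryParam E c L) (hE : Convex ℝ E)
    (hi : (interior E).Nonempty) (s : ℝ) {x : ℝ × ℝ} (hx : x ∈ closure E) :
    (x.1 - (c s).1) * (deriv c s).2 - (x.2 - (c s).2) * (deriv c s).1 ≤ 0 := by
  rw [← hE.closure_interior_eq_closure_of_nonempty_interior hi] at hx
  have hclosed : IsClosed {x : ℝ × ℝ |
      (x.1 - (c s).1) * (deriv c s).2 - (x.2 - (c s).2) * (deriv c s).1 ≤ 0} :=
    isClosed_le (by fun_prop) continuous_const
  exact closure_minimal (fun z hz => (hb.support_interior hE hi s hz).le) hclosed hx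

theorem curvature_nonneg (hb : IsBoundaryParam E c L) (hE : Convex ℝ E)
    (hi : (interior E).Nonempty) (s : ℝ) : 0 ≤ curvature c s := by
  -- The height `h` over the tangent line at `s` has a maximum at `s`, where `h'' = -κ`.
  by_contra hneg
  push Not at hneg
  set h : ℝ → ℝ := fun t =>
    ((c t).1 - (c s).1) * (deriv c s).2 - ((c t).2 - (c s).2) * (deriv c s).1 with hh
  have hd : ∀ t, HasDerivAt h
      ((deriv c t).1 * (deriv c s).2 - (deriv c t).2 * (deriv c s).1) t := fun t =>
    (((hb.hasDerivAt_fst t).sub_const _).mul_const _).sub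
      (((hb.hasDerivAt_snd t).sub_const _).mul_const _)
  have hderiv : deriv h = fun t =>
      (deriv c t).1 * (deriv c s).2 - (deriv c t).2 * (deriv c s).1 := funext fun t => (hd t).deriv
  have hd2 : HasDerivAt (deriv h) (-curvature c s) s := by
    rw [hderiv]
    have := ((hb.hasDerivAt_deriv_fst s).mul_const (deriv c s).2).sub
      ((hb.hasDerivAt_deriv_snd s).mul_const (deriv c s).1)
    convert! this using 1
    unfold curvature; ring
  have hzero : deriv h s = 0 := by rw [hderiv]; ring
  have hpos : ∀ᶠ t in 𝓝[>] s, 0 < deriv h t := by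
    have hslope := (hasDerivAt_iff_tendsto_slope.1 hd2).mono_left
      (nhdsWithin_mono s (fun t (ht : s < t) => ht.ne'))
    filter_upwards [hslope.eventually (lt_mem_nhds (by linarith : 0 < -curvature c s)),
      self_mem_nhdsWithin] with t ht hst
    rw [slope_def_field, hzero, sub_zero] at ht
    exact (div_pos_iff_of_pos_right (sub_pos.2 hst)).1 ht
  obtain ⟨u, hu, hsub⟩ := mem_nhdsGT_iff_exists_Ioo_subset.1 hpos
  rw [mem_Ioi] at hu
  have hmono : StrictMonoOn h (Icc s ((s + u) / 2)) := by
    refine strictMonoOn_of_deriv_pos (convex_Icc _ _)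
      (fun t _ => (hd t).continuousAt.continuousWithinAt) fun t ht => ?_
    rw [interior_Icc] at ht
    exact hsub ⟨ht.1, by linarith [ht.2]⟩
  have h1 := hmono (left_mem_Icc.2 (by linarith)) (right_mem_Icc.2 (by linarith))
    (by linarith : s < (s + u) / 2)
  have h2 := hb.support hE hi s (hb.mem_closure ((s + u) / 2))
  simp only [hh, sub_self, zero_mul] at h1
  linarith

end IsBoundaryParam

end Curve

/-! ### Radial coordinates about an interior point -/

section Radial

variable {E : Set (ℝ × ℝ)} {c : ℝ → ℝ × ℝ} {L : ℝ}

/-- Radial coordinates `(s, t) ↦ p + t (c s - p)` on the region enclosed by `c`. -/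
def radialMap (c : ℝ → ℝ × ℝ) (p : ℝ × ℝ) (q : ℝ × ℝ) : ℝ × ℝ := p + q.2 • (c q.1 - p)

/-- The height `(c s - p) · n` of the tangent line at `c s` above `p`. -/
def supportHeight (c : ℝ → ℝ × ℝ) (p : ℝ × ℝ) (s : ℝ) : ℝ :=
  ((c s).1 - p.1) * (deriv c s).2 - ((c s).2 - p.2) * (deriv c s).1

/-- The derivative of `radialMap c p`. -/
def fderivRadialMap (c : ℝ → ℝ × ℝ) (p : ℝ × ℝ) (q : ℝ × ℝ) : ℝ × ℝ →L[ℝ] ℝ × ℝ :=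
  (Matrix.toLin (.finTwoProd ℝ) (.finTwoProd ℝ)
    !![q.2 * (deriv c q.1).1, (c q.1).1 - p.1;
       q.2 * (deriv c q.1).2, (c q.1).2 - p.2]).toContinuousLinearMap

theorem det_fderivRadialMap (c : ℝ → ℝ × ℝ) (p q : ℝ × ℝ) :
    (fderivRadialMap c p q).det = -(q.2 * supportHeight c p q.1) := by
  unfold fderivRadialMap supportHeight
  simp only [LinearMap.det_toContinuousLinearMap, LinearMap.det_toLin, Matrix.det_fin_two_of]
  ring

namespace IsBoundaryParam

theorem continuous_radialMap (hb : IsBoundaryParam E c L) (p : ℝ × ℝ) :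
    Continuous (radialMap c p) := by
  have := hb.continuous
  unfold radialMap
  fun_prop

theorem continuous_supportHeight (hb : IsBoundaryParam E c L) (p : ℝ × ℝ) :
    Continuous (supportHeight c p) := by
  have := hb.continuous_fst
  have := hb.continuous_snd
  have := hb.continuous_deriv_fst
  have := hb.continuous_deriv_snd
  unfold supportHeight
  fun_prop

theorem hasFDerivAt_radialMap (hb : IsBoundaryParam E c L) (p q : ℝ × ℝ) :
    HasFDerivAt (radialMap c p) (fderivRadialMap c p q) q := by
  unfold fderivRadialMap
  rw [Matrix.toLin_finTwoProd_toContinuousLinearMap]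
  have h1 : HasFDerivAt (fun q : ℝ × ℝ => (c q.1).1 - p.1)
      ((deriv c q.1).1 • ContinuousLinearMap.fst ℝ ℝ ℝ) q :=
    ((hb.hasDerivAt_fst q.1).sub_const p.1).comp_hasFDerivAt q hasFDerivAt_fst
  have h2 : HasFDerivAt (fun q : ℝ × ℝ => (c q.1).2 - p.2)
      ((deriv c q.1).2 • ContinuousLinearMap.fst ℝ ℝ ℝ) q :=
    ((hb.hasDerivAt_snd q.1).sub_const p.2).comp_hasFDerivAt q hasFDerivAt_fst
  have h3 := ((hasFDerivAt_snd (𝕜 := ℝ) (p := q)).mul h1).const_add p.1 |>.prodMk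
    (((hasFDerivAt_snd (𝕜 := ℝ) (p := q)).mul h2).const_add p.2)
  have he : radialMap c p =
      fun q => (p.1 + q.2 * ((c q.1).1 - p.1), p.2 + q.2 * ((c q.1).2 - p.2)) := by
    funext q
    simp [radialMap, Prod.ext_iff]
  rw [he]
  convert! h3 using 2 <;> simp [smul_smul]

theorem supportHeight_pos (hb : IsBoundaryParam E c L) (hE : Convex ℝ E) {p : ℝ × ℝ}
    (hp : p ∈ interior E) (s : ℝ) : 0 < supportHeight c p s := by
  have := hb.support_interior hE ⟨p, hp⟩ s hp
  unfold supportHeight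
  linarith

theorem radialMap_mem_interior (hb : IsBoundaryParam E c L) (hE : Convex ℝ E) {p : ℝ × ℝ}
    (hp : p ∈ interior E) {q : ℝ × ℝ} (h0 : 0 ≤ q.2) (h1 : q.2 < 1) :
    radialMap c p q ∈ interior E := by
  rcases h0.eq_or_lt with h | h
  · simpa [radialMap, ← h] using hp
  · refine hE.openSegment_interior_closure_subset_interior hp (hb.mem_closure q.1)
      ⟨1 - q.2, q.2, by linarith, h, by ring, ?_⟩
    unfold radialMap
    module

theorem injOn_radialMap (hb : IsBoundaryParam E c L) (hE : Convex ℝ E) {p : ℝ × ℝ}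
    (hp : p ∈ interior E) : InjOn (radialMap c p) (Ico 0 L ×ˢ Ioo 0 1) := by
  -- Two boundary points on the same ray from `p` are at the same distance from `p`.
  have key : ∀ s₁ s₂ t₁ t₂ : ℝ, 0 < t₁ → t₁ < t₂ →
      radialMap c p (s₁, t₁) ≠ radialMap c p (s₂, t₂) := by
    intro s₁ s₂ t₁ t₂ h1 h12 heq
    have ht2 : 0 < t₂ := h1.trans h12
    apply hb.notMem_interior s₂
    have hc : c s₂ = radialMap c p (s₁, t₁ / t₂) := by
      have h3 : t₂ • (c s₂ - p) = t₁ • (c s₁ - p) := by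
        simpa [radialMap] using heq.symm
      have h4 : c s₂ - p = (t₁ / t₂) • (c s₁ - p) := by
        rw [div_eq_inv_mul, mul_smul, ← h3, smul_smul, inv_mul_cancel₀ ht2.ne', one_smul]
      simp only [radialMap, ← h4]
      abel
    rw [hc]
    exact hb.radialMap_mem_interior hE hp (div_pos h1 ht2).le ((div_lt_one ht2).2 h12)
  rintro ⟨s₁, t₁⟩ ⟨hs1, ht1⟩ ⟨s₂, t₂⟩ ⟨hs2, ht2⟩ heq
  rcases lt_trichotomy t₁ t₂ with h | h | h
  · exact absurd heq (key _ _ _ _ ht1.1 h)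
  · obtain rfl : t₁ = t₂ := h
    have h3 : t₁ • (c s₁ - p) = t₁ • (c s₂ - p) := by simpa [radialMap] using heq
    have h4 : c s₁ = c s₂ := sub_left_injective (smul_right_injective _ (ne_of_gt ht1.1) h3)
    exact Prod.ext (hb.injOn hs1 hs2 h4) rfl
  · exact absurd heq.symm (key _ _ _ _ ht2.1 h)

theorem image_radialMap (hb : IsBoundaryParam E c L) (hE : Convex ℝ E)
    (hbd : Bornology.IsBounded E) {p : ℝ × ℝ} (hp : p ∈ interior E) :
    radialMap c p '' (Ico 0 L ×ˢ Ioo 0 1) = interior E \ {p} := by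
  ext x
  constructor
  · rintro ⟨q, ⟨hq1, hq2⟩, rfl⟩
    refine ⟨hb.radialMap_mem_interior hE hp hq2.1.le hq2.2, fun h => ?_⟩
    have h3 : q.2 • (c q.1 - p) = 0 := by simpa [radialMap] using h
    rcases smul_eq_zero.1 h3 with h4 | h4
    · exact hq2.1.ne' h4
    · exact hb.notMem_interior q.1 (by rwa [sub_eq_zero.1 h4])
  · rintro ⟨hx, hxp⟩
    have hxp' : x - p ≠ 0 := sub_ne_zero.2 hxp
    -- The last point of the ray from `p` through `x` that lies in `closure E`.
    set T : Set ℝ := {u | 0 ≤ u ∧ p + u • (x - p) ∈ closure E} with hT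
    have hTclosed : IsClosed T := by
      have : Continuous fun u : ℝ => p + u • (x - p) := by fun_prop
      exact isClosed_Ici.inter (isClosed_closure.preimage this)
    have hTbdd : BddAbove T := by
      obtain ⟨M, hM⟩ := (hbd.closure).exists_norm_le
      refine ⟨(M + ‖p‖) / ‖x - p‖, fun u hu => ?_⟩
      rw [le_div_iff₀ (norm_pos_iff.2 hxp')]
      calc u * ‖x - p‖ = ‖(p + u • (x - p)) - p‖ := by
            rw [add_sub_cancel_left, norm_smul, Real.norm_of_nonneg hu.1]
        _ ≤ ‖p + u • (x - p)‖ + ‖p‖ := norm_sub_le _ _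
        _ ≤ M + ‖p‖ := by gcongr; exact hM _ hu.2
    have h1T : (1 : ℝ) ∈ T := ⟨zero_le_one, by simpa using interior_subset_closure hx⟩
    have huT : sSup T ∈ T := hTclosed.csSup_mem ⟨1, h1T⟩ hTbdd
    set u := sSup T with hu
    have hu1 : 1 ≤ u := le_csSup hTbdd h1T
    have hint : p + u • (x - p) ∉ interior E := by
      intro h
      have hcont : Continuous fun u : ℝ => p + u • (x - p) := by fun_prop
      have hev : ∀ᶠ v in 𝓝 u, p + v • (x - p) ∈ interior E :=
        hcont.continuousAt.eventually (isOpen_interior.mem_nhds h)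
      obtain ⟨v, hv, huv⟩ := ((hev.filter_mono nhdsWithin_le_nhds).and
        (self_mem_nhdsWithin : Ioi u ∈ 𝓝[>] u)).exists
      have hvT : v ∈ T := ⟨huT.1.trans (le_of_lt huv), interior_subset_closure hv⟩
      exact absurd (le_csSup hTbdd hvT) (not_le.2 huv)
    have hu1' : 1 < u := by
      refine lt_of_le_of_ne hu1 fun h => hint ?_
      rw [← h]; simpa using hx
    obtain ⟨s, hs, hcs⟩ : p + u • (x - p) ∈ c '' Ico 0 L := by
      rw [hb.image_eq]; exact ⟨huT.2, hint⟩
    refine ⟨(s, u⁻¹), ⟨hs, inv_pos.2 (by linarith), inv_lt_one_of_one_lt₀ hu1'⟩, ?_⟩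
    simp only [radialMap, hcs, add_sub_cancel_left, smul_smul,
      inv_mul_cancel₀ (by linarith : u ≠ 0), one_smul]
    abel

/-- Integration over `E` in radial coordinates; the Jacobian is `t (c s - p) · n`. -/
theorem setIntegral_eq_radial (hb : IsBoundaryParam E c L) (hE : Convex ℝ E)
    (hbd : Bornology.IsBounded E) {p : ℝ × ℝ} (hp : p ∈ interior E) (f : ℝ × ℝ → ℝ) :
    ∫ x in E, f x = ∫ q in Ico 0 L ×ˢ Ioo 0 1,
      q.2 * supportHeight c p q.1 * f (radialMap c p q) := by
  have h1 : (E : Set (ℝ × ℝ)) =ᵐ[volume] (interior E \ {p} : Set (ℝ × ℝ)) := by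
    have hfr : volume (frontier E) = 0 := hE.addHaar_frontier volume
    have h2 : (interior E \ {p} : Set (ℝ × ℝ)) =ᵐ[volume] interior E :=
      sdiff_null_ae_eq_self (measure_singleton p)
    exact (h2.trans (interior_ae_eq_of_null_frontier hfr)).symm
  rw [setIntegral_congr_set h1, ← hb.image_radialMap hE hbd hp,
    integral_image_eq_integral_abs_det_fderiv_smul volume
      (measurableSet_Ico.prod measurableSet_Ioo)
      (fun q _ => (hb.hasFDerivAt_radialMap p q).hasFDerivWithinAt)
      (hb.injOn_radialMap hE hp)]
  refine setIntegral_congr_fun (measurableSet_Ico.prod measurableSet_Ioo) fun q hq => ?_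
  have := mul_pos hq.2.1 (hb.supportHeight_pos hE hp q.1)
  simp only [det_fderivRadialMap, abs_neg, abs_of_pos this, smul_eq_mul]

end IsBoundaryParam

end Radial

/-! ### The divergence theorem and the total curvature -/

section Radial

variable {E : Set (ℝ × ℝ)} {c : ℝ → ℝ × ℝ} {L : ℝ}

theorem setIntegral_Ico_prod_Ioo {F : ℝ × ℝ → ℝ} (hL : 0 ≤ L)
    (hF : IntegrableOn F (Ico 0 L ×ˢ Ioo 0 1)) :
    ∫ q in Ico 0 L ×ˢ Ioo 0 1, F q = ∫ s in (0 : ℝ)..L, ∫ t in Ioo 0 1, F (s, t) := by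
  rw [Measure.volume_eq_prod, setIntegral_prod _ hF, integral_Ico_eq_integral_Ioc,
    intervalIntegral.integral_of_le hL]

namespace IsBoundaryParam

/-- The integral over a period of the derivative of a periodic function vanishes. -/
theorem integral_deriv_eq_zero (hb : IsBoundaryParam E c L) {f f' : ℝ → ℝ}
    (hf : ∀ s, HasDerivAt f (f' s) s) (hf' : Continuous f') (hper : f L = f 0) :
    ∫ s in (0 : ℝ)..L, f' s = 0 := by
  have := hb.length_pos
  rw [intervalIntegral.integral_eq_sub_of_hasDerivAt (fun s _ => hf s)
    (hf'.intervalIntegrable _ _), hper, sub_self]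

/-- The divergence theorem for the vector field `-(r + τ)⁻¹ e_r` on `E`. In radial coordinates
`(s, t)` about an interior point, the integrand on the left differs from
`∂_t (-t / (r + τ)) z'(s)` by an `s`-derivative of a periodic function. -/
theorem setIntegral_inv_sq (hb : IsBoundaryParam E c L) (hE : IsCrossSection E)
    {τ : ℝ} (hτ : 0 ≤ τ) :
    ∫ x in E, 1 / (x.1 + τ) ^ 2 = -∫ s in (0 : ℝ)..L, (deriv c s).2 / ((c s).1 + τ) := by
  obtain ⟨p, hp⟩ := hE.interior_nonempty
  rw [hb.setIntegral_eq_radial hE.convex hE.bounded hp]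
  have hL := hb.length_pos.le
  set x : ℝ → ℝ := fun s => (c s).1 - p.1 with hx
  set y : ℝ → ℝ := fun s => (c s).2 - p.2 with hy
  have hp1 : 0 < p.1 := hE.closure_subset (interior_subset_closure hp)
  have hc1 : ∀ s, 0 < (c s).1 := fun s => hE.closure_subset (hb.mem_closure s)
  have hu : ∀ s, ∀ t ∈ Icc (0 : ℝ) 1, 0 < p.1 + t * x s + τ := by
    intro s t ht
    have h0 : p.1 + t * x s = (1 - t) * p.1 + t * (c s).1 := by simp only [hx]; ring
    rw [h0]
    rcases ht.2.eq_or_lt with h | h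
    · rw [h]; linarith [hc1 s]
    · have := mul_pos (sub_pos.2 h) hp1
      have := mul_nonneg ht.1 (hc1 s).le
      linarith
  have cx : Continuous x := hb.continuous_fst.sub continuous_const
  have cy : Continuous y := hb.continuous_snd.sub continuous_const
  have cz := hb.continuous_deriv_snd
  have ch := hb.continuous_supportHeight p
  have hIcc : Ico 0 L ×ˢ Ioo (0 : ℝ) 1 ⊆ Icc 0 L ×ˢ Icc 0 1 :=
    prod_mono Ico_subset_Icc_self Ioo_subset_Icc_self
  have hcont : ∀ {F : ℝ × ℝ → ℝ}, ContinuousOn F (univ ×ˢ Icc 0 1) →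
      IntegrableOn F (Icc 0 L ×ˢ Icc 0 1) := fun hF =>
    (hF.mono (prod_mono (subset_univ _) subset_rfl)).integrableOn_compact
      (isCompact_Icc.prod isCompact_Icc)
  have hswap : ∀ {F : ℝ × ℝ → ℝ}, ContinuousOn F (univ ×ˢ Icc 0 1) →
      ∫ s in (0 : ℝ)..L, ∫ t in (0 : ℝ)..1, F (s, t)
        = ∫ t in (0 : ℝ)..1, ∫ s in (0 : ℝ)..L, F (s, t) := by
    intro F hF
    refine intervalIntegral_intervalIntegral_swap (F := fun s t => F (s, t)) ?_
    rw [uIoc_of_le hL, uIoc_of_le zero_le_one]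
    exact (hcont hF).mono_set (prod_mono Ioc_subset_Icc_self Ioc_subset_Icc_self)
  have hne : ∀ q ∈ (univ : Set ℝ) ×ˢ Icc (0 : ℝ) 1, p.1 + q.2 * x q.1 + τ ≠ 0 :=
    fun q hq => (hu q.1 q.2 hq.2).ne'
  set F : ℝ × ℝ → ℝ := fun q => q.2 * supportHeight c p q.1 / (p.1 + q.2 * x q.1 + τ) ^ 2
  set G : ℝ × ℝ → ℝ := fun q =>
    (q.2 * x q.1 / (p.1 + q.2 * x q.1 + τ) ^ 2 - 1 / (p.1 + q.2 * x q.1 + τ)) * (deriv c q.1).2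
  have hF : ContinuousOn F (univ ×ˢ Icc 0 1) :=
    ContinuousOn.div (by fun_prop) (by fun_prop) fun q hq => pow_ne_zero 2 (hne q hq)
  have hG : ContinuousOn G (univ ×ˢ Icc 0 1) :=
    ContinuousOn.mul (ContinuousOn.sub
      (ContinuousOn.div (by fun_prop) (by fun_prop) fun q hq => pow_ne_zero 2 (hne q hq))
      (ContinuousOn.div (by fun_prop) (by fun_prop) hne))
      (cz.comp _root_.continuous_fst).continuousOn
  have h1 : ∫ q in Ico 0 L ×ˢ Ioo 0 1,
        q.2 * supportHeight c p q.1 * (1 / ((radialMap c p q).1 + τ) ^ 2)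
      = ∫ q in Ico 0 L ×ˢ Ioo 0 1, F q :=
    setIntegral_congr_fun (measurableSet_Ico.prod measurableSet_Ioo) fun q _ => by
      simp [F, radialMap, hx, div_eq_mul_inv]
  have h2 : ∀ s, ∫ t in Ioo 0 1, F (s, t) = ∫ t in (0 : ℝ)..1, F (s, t) := fun s => by
    rw [intervalIntegral.integral_of_le zero_le_one, integral_Ioc_eq_integral_Ioo]
  rw [h1, setIntegral_Ico_prod_Ioo hL ((hcont hF).mono_set hIcc)]
  simp only [h2]
  -- For fixed `t`, the difference of the two integrands is the `s`-derivative of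
  -- `y / (r + τ)`, where `(x, y)` are the coordinates relative to `p` and `r = p.1 + t x`.
  have hFG : ∀ t ∈ Icc (0 : ℝ) 1, ∫ s in (0 : ℝ)..L, F (s, t) = ∫ s in (0 : ℝ)..L, G (s, t) := by
    intro t ht
    have cslice : Continuous fun s : ℝ => (s, t) := by fun_prop
    have hmaps : ∀ s : ℝ, (s, t) ∈ (univ : Set ℝ) ×ˢ Icc (0 : ℝ) 1 := fun s => ⟨mem_univ _, ht⟩
    have cF : Continuous fun s => F (s, t) := hF.comp_continuous cslice hmaps
    have cG : Continuous fun s => G (s, t) := hG.comp_continuous cslice hmaps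
    rw [← sub_eq_zero, ← intervalIntegral.integral_sub (cF.intervalIntegrable _ _)
      (cG.intervalIntegrable _ _)]
    refine hb.integral_deriv_eq_zero (f := fun s => y s / (p.1 + t * x s + τ)) (fun s => ?_)
      (cF.sub cG) ?_
    · have hus := (hu s t ht).ne'
      have hdx : HasDerivAt x (deriv c s).1 s := (hb.hasDerivAt_fst s).sub_const _
      have hdy : HasDerivAt y (deriv c s).2 s := (hb.hasDerivAt_snd s).sub_const _
      have := hdy.div (((hdx.const_mul t).const_add p.1).add_const τ) hus
      convert! this using 1
      simp only [F, G, supportHeight]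
      change t * (x s * (deriv c s).2 - y s * (deriv c s).1) / _ - _ = _
      field_simp
      ring
    · simp [hx, hy, hb.apply_length]
  have hGt : ∀ s, ∫ t in (0 : ℝ)..1, G (s, t) = -((deriv c s).2 / ((c s).1 + τ)) := by
    intro s
    have hint : IntervalIntegrable (fun t => G (s, t)) volume 0 1 := by
      apply ContinuousOn.intervalIntegrable
      rw [uIcc_of_le zero_le_one]
      exact hG.comp (by fun_prop) fun t ht => ⟨mem_univ _, ht⟩
    rw [intervalIntegral.integral_eq_sub_of_hasDerivAt
      (f := fun t => -t / (p.1 + t * x s + τ) * (deriv c s).2) (fun t ht => ?_) hint]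
    · simp [hx]; ring
    · rw [uIcc_of_le zero_le_one] at ht
      have hus := (hu s t ht).ne'
      have := ((hasDerivAt_id t).neg.div
        ((((hasDerivAt_id t).mul_const (x s)).const_add p.1).add_const τ) hus).mul_const
          (deriv c s).2
      convert! this using 1
      simp only [G, id, Pi.neg_apply]
      field_simp
      ring
  rw [hswap hF, intervalIntegral.integral_congr (g := fun t => ∫ s in (0 : ℝ)..L, G (s, t))
    (fun t ht => hFG t (by rwa [uIcc_of_le zero_le_one] at ht)), ← hswap hG]
  simp only [hGt, intervalIntegral.integral_neg]

end IsBoundaryParam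

theorem volume_disc (p : ℝ × ℝ) {ε : ℝ} (hε : 0 < ε) :
    volume.real {x : ℝ × ℝ | (x.1 - p.1) ^ 2 + (x.2 - p.2) ^ 2 < ε ^ 2} = Real.pi * ε ^ 2 := by
  have hpre : Complex.measurableEquivRealProd ⁻¹'
      {x : ℝ × ℝ | (x.1 - p.1) ^ 2 + (x.2 - p.2) ^ 2 < ε ^ 2} = Metric.ball ⟨p.1, p.2⟩ ε := by
    ext w
    rw [mem_preimage, Metric.mem_ball, Complex.dist_eq_re_im, mem_ofPred_eq,
      Real.sqrt_lt' hε]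
    rfl
  rw [Measure.real, ← Complex.volume_preserving_equiv_real_prod.measure_preimage_equiv, hpre,
    Complex.volume_ball, ENNReal.toReal_mul, ENNReal.toReal_pow, ENNReal.toReal_ofReal hε.le,
    mul_comm]
  rfl

namespace IsBoundaryParam

/-- The winding number of the boundary about an interior point is one: comparing areas of a small
disc about `p`, computed directly and in the radial coordinates. -/
theorem integral_supportHeight_div (hb : IsBoundaryParam E c L) (hE : Convex ℝ E)
    (hbd : Bornology.IsBounded E) {p : ℝ × ℝ} (hp : p ∈ interior E) :
    ∫ s in (0 : ℝ)..L, supportHeight c p s / (((c s).1 - p.1) ^ 2 + ((c s).2 - p.2) ^ 2)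
      = 2 * Real.pi := by
  have hL := hb.length_pos.le
  obtain ⟨ε, hε, hball⟩ := Metric.isOpen_iff.1 isOpen_interior p hp
  set B : Set (ℝ × ℝ) := {x | (x.1 - p.1) ^ 2 + (x.2 - p.2) ^ 2 < ε ^ 2} with hB
  have hBE : B ⊆ interior E := by
    intro x hx
    refine hball ?_
    rw [Metric.mem_ball, Prod.dist_eq, max_lt_iff, Real.dist_eq, Real.dist_eq]
    have hx' : (x.1 - p.1) ^ 2 + (x.2 - p.2) ^ 2 < ε ^ 2 := hx
    exact ⟨abs_lt_of_sq_lt_sq (by nlinarith [sq_nonneg (x.2 - p.2)]) hε.le,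
      abs_lt_of_sq_lt_sq (by nlinarith [sq_nonneg (x.1 - p.1)]) hε.le⟩
  have hBm : MeasurableSet B :=
    measurableSet_lt (by fun_prop) measurable_const
  set N : ℝ → ℝ := fun s => ((c s).1 - p.1) ^ 2 + ((c s).2 - p.2) ^ 2 with hN
  have hNε : ∀ s, ε ^ 2 ≤ N s := fun s => not_lt.1 fun h => hb.notMem_interior s (hBE h)
  have hNpos : ∀ s, 0 < N s := fun s => (pow_pos hε 2).trans_le (hNε s)
  have h1 := hb.setIntegral_eq_radial hE hbd hp (B.indicator 1)
  have hleft : ∫ x in E, B.indicator (1 : ℝ × ℝ → ℝ) x = Real.pi * ε ^ 2 := by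
    rw [integral_indicator_one hBm, measureReal_restrict_apply hBm,
      inter_eq_left.2 (hBE.trans interior_subset), volume_disc p hε]
  set F : ℝ × ℝ → ℝ := fun q => q.2 * supportHeight c p q.1 * B.indicator 1 (radialMap c p q)
    with hF
  have hFind : F = (radialMap c p ⁻¹' B).indicator fun q => q.2 * supportHeight c p q.1 := by
    funext q
    by_cases h : radialMap c p q ∈ B
    · simp [F, h]
    · simp [F, h]
  have hFint : IntegrableOn F (Ico 0 L ×ˢ Ioo 0 1) := by
    have ch := hb.continuous_supportHeight p
    have : IntegrableOn (fun q : ℝ × ℝ => q.2 * supportHeight c p q.1) (Ico 0 L ×ˢ Ioo 0 1) :=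
      ((by fun_prop : Continuous fun q : ℝ × ℝ =>
        q.2 * supportHeight c p q.1).continuousOn.integrableOn_compact
        (isCompact_Icc.prod isCompact_Icc)).mono_set
        (prod_mono Ico_subset_Icc_self Ioo_subset_Icc_self)
    rw [hFind]
    exact this.indicator ((hb.continuous_radialMap p).measurable hBm)
  have hinner : ∀ s, ∫ t in Ioo 0 1, F (s, t) = ε ^ 2 / 2 * (supportHeight c p s / N s) := by
    intro s
    set ρ := ε / √(N s) with hρ
    have hsq : 0 < √(N s) := Real.sqrt_pos.2 (hNpos s)
    have hρ0 : 0 < ρ := div_pos hε hsq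
    have hρ1 : ρ ≤ 1 := (div_le_one hsq).2 (Real.le_sqrt_of_sq_le (hNε s))
    have hρ2 : ρ ^ 2 = ε ^ 2 / N s := by rw [hρ, div_pow, Real.sq_sqrt (hNpos s).le]
    have hiff : ∀ t : ℝ, 0 < t → (radialMap c p (s, t) ∈ B ↔ t < ρ) := by
      intro t ht
      have h0 : radialMap c p (s, t) ∈ B ↔ t ^ 2 * N s < ε ^ 2 := by
        simp only [hB, radialMap, mem_ofPred_eq, Prod.fst_add, Prod.snd_add, add_sub_cancel_left,
          Prod.smul_fst, Prod.smul_snd, Prod.fst_sub, Prod.snd_sub, smul_eq_mul, hN]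
        rw [mul_pow, mul_pow, mul_add]
      rw [h0, ← lt_div_iff₀ (hNpos s), ← hρ2, sq_lt_sq₀ ht.le hρ0.le]
    have hset : ∫ t in Ioo 0 1, F (s, t)
        = ∫ t in Ioo 0 1, (Ioo 0 ρ).indicator (fun t => t * supportHeight c p s) t := by
      refine setIntegral_congr_fun measurableSet_Ioo fun t ht => ?_
      by_cases h : t < ρ
      · simp [F, (hiff t ht.1).2 h, indicator_of_mem (show t ∈ Ioo 0 ρ from ⟨ht.1, h⟩)]
      · simp [F, mt (hiff t ht.1).1 h, indicator_of_notMem (fun hm : t ∈ Ioo 0 ρ => h hm.2)]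
    rw [hset, setIntegral_indicator measurableSet_Ioo,
      inter_eq_right.2 (Ioo_subset_Ioo_right hρ1), ← integral_Ioc_eq_integral_Ioo,
      ← intervalIntegral.integral_of_le hρ0.le, intervalIntegral.integral_mul_const, integral_id,
      hρ2]
    ring
  rw [hleft, setIntegral_Ico_prod_Ioo hL hFint] at h1
  simp only [hinner, intervalIntegral.integral_const_mul] at h1
  have hε2 : ε ^ 2 ≠ 0 := (pow_pos hε 2).ne'
  have : ε ^ 2 * (∫ s in (0 : ℝ)..L, supportHeight c p s / N s) = ε ^ 2 * (2 * Real.pi) := by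
    linarith
  exact mul_left_cancel₀ hε2 this

/-- The total curvature of the boundary of a convex set is `2π`. The angle between the normal `n`
and the radius `c - p` is the arctangent of a periodic function, since `(c - p) · n > 0`; so the
normal turns exactly as often as the radius, that is, once. -/
theorem integral_curvature (hb : IsBoundaryParam E c L) (hE : Convex ℝ E)
    (hbd : Bornology.IsBounded E) (hi : (interior E).Nonempty) :
    ∫ s in (0 : ℝ)..L, curvature c s = 2 * Real.pi := by
  obtain ⟨p, hp⟩ := hi
  set h := supportHeight c p with hh
  set v : ℝ → ℝ := fun s =>
    -(((c s).1 - p.1) * (deriv c s).1 + ((c s).2 - p.2) * (deriv c s).2) with hv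
  set N : ℝ → ℝ := fun s => ((c s).1 - p.1) ^ 2 + ((c s).2 - p.2) ^ 2 with hN
  have hhpos : ∀ s, 0 < h s := hb.supportHeight_pos hE hp
  have hNhv : ∀ s, h s ^ 2 + v s ^ 2 = N s := by
    intro s
    simp only [hh, hv, hN, supportHeight]
    linear_combination (((c s).1 - p.1) ^ 2 + ((c s).2 - p.2) ^ 2) * hb.unit_speed s
  have hNpos : ∀ s, 0 < N s := fun s => by
    rw [← hNhv]; have := hhpos s; positivity
  have hdx : ∀ s, HasDerivAt (fun s => (c s).1 - p.1) (deriv c s).1 s := fun s =>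
    (hb.hasDerivAt_fst s).sub_const _
  have hdy : ∀ s, HasDerivAt (fun s => (c s).2 - p.2) (deriv c s).2 s := fun s =>
    (hb.hasDerivAt_snd s).sub_const _
  have hdh : ∀ s, HasDerivAt h (-(curvature c s * v s)) s := by
    intro s
    have := ((hdx s).mul (hb.hasDerivAt_deriv_snd s)).sub ((hdy s).mul (hb.hasDerivAt_deriv_fst s))
    convert! this using 1
    rw [hb.deriv_deriv_fst, hb.deriv_deriv_snd]
    simp only [hv]
    ring
  have hdv : ∀ s, HasDerivAt v (curvature c s * h s - 1) s := by
    intro s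
    have := (((hdx s).mul (hb.hasDerivAt_deriv_fst s)).add
      ((hdy s).mul (hb.hasDerivAt_deriv_snd s))).neg
    convert! this using 1
    rw [hb.deriv_deriv_fst, hb.deriv_deriv_snd]
    simp only [hh, supportHeight]
    linear_combination hb.unit_speed s
  have hda : ∀ s, HasDerivAt (fun s => Real.arctan (v s / h s)) (curvature c s - h s / N s) s := by
    intro s
    have := ((hdv s).div (hdh s) (hhpos s).ne').arctan
    convert! this using 1
    have h1 := (hhpos s).ne'
    have h2 : h s ^ 2 + v s ^ 2 ≠ 0 := by rw [hNhv]; exact (hNpos s).ne'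
    rw [← hNhv]
    have h3 : 1 + (v s / h s) ^ 2 = (h s ^ 2 + v s ^ 2) / h s ^ 2 := by field_simp
    simp only [Pi.div_apply, h3]
    field_simp
    ring
  have ch : Continuous h := hb.continuous_supportHeight p
  have cN : Continuous N :=
    ((hb.continuous_fst.sub continuous_const).pow 2).add
      ((hb.continuous_snd.sub continuous_const).pow 2)
  have chN : Continuous fun s => h s / N s := ch.div cN fun s => (hNpos s).ne'
  have h0 := hb.integral_deriv_eq_zero hda (hb.continuous_curvature.sub chN) (by
    simp only [hv, hh, supportHeight, hb.apply_length, hb.deriv_apply_length])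
  rw [intervalIntegral.integral_sub (hb.continuous_curvature.intervalIntegrable _ _)
    (chN.intervalIntegrable _ _), hb.integral_supportHeight_div hE hbd hp] at h0
  linarith

end IsBoundaryParam

end Radial

/-! ### Size of a cross-section -/

section Size

variable {E : Set (ℝ × ℝ)} {c : ℝ → ℝ × ℝ} {L : ℝ}

/-- The numbers `b = max r` and `h = max z` over `closure E` measure the size of a cross-section;
by convexity and symmetry, the maximum of `r` is attained on the axis `z = 0`. -/
structure HasExtents (E : Set (ℝ × ℝ)) (b h : ℝ) : Prop where
  fst_le : ∀ x ∈ closure E, x.1 ≤ b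
  abs_snd_le : ∀ x ∈ closure E, |x.2| ≤ h
  right_mem : (b, 0) ∈ closure E
  exists_top : ∃ m, (m, h) ∈ closure E

namespace IsCrossSection

theorem symmetric_closure (hE : IsCrossSection E) {r z : ℝ} (h : (r, z) ∈ closure E) :
    (r, -z) ∈ closure E := by
  have hcl : IsClosed ((fun x : ℝ × ℝ => (x.1, -x.2)) ⁻¹' closure E) :=
    isClosed_closure.preimage (by fun_prop)
  have hsub : E ⊆ (fun x : ℝ × ℝ => (x.1, -x.2)) ⁻¹' closure E := fun x hx =>
    subset_closure (hE.symmetric x.1 x.2 hx)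
  exact closure_minimal hsub hcl h

theorem segment_mem_closure (hE : IsCrossSection E) {r z w : ℝ} (h : (r, z) ∈ closure E)
    (hw : |w| ≤ |z|) : (r, w) ∈ closure E := by
  rcases eq_or_ne z 0 with rfl | hz
  · rw [abs_zero] at hw
    rwa [abs_nonpos_iff.1 hw]
  · have hθ := abs_le.1 (show |w / z| ≤ 1 by
      rw [abs_div]; exact div_le_one_of_le₀ hw (abs_nonneg _))
    have hconv := hE.convex.closure h (hE.symmetric_closure h)
      (by linarith : 0 ≤ (1 + w / z) / 2) (by linarith : 0 ≤ (1 - w / z) / 2) (by ring)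
    convert hconv using 1
    ext
    · simp; ring
    · simp; field_simp; ring

theorem isCompact_closure (hE : IsCrossSection E) : IsCompact (closure E) :=
  hE.bounded.isCompact_closure

theorem exists_hasExtents (hE : IsCrossSection E) : ∃ b h, HasExtents E b h := by
  have hne : (closure E).Nonempty := hE.interior_nonempty.mono interior_subset_closure
  obtain ⟨q, hq, hqmax⟩ := hE.isCompact_closure.exists_isMaxOn hne
    _root_.continuous_fst.continuousOn
  obtain ⟨m, hm, hmmax⟩ := hE.isCompact_closure.exists_isMaxOn hne
    _root_.continuous_snd.continuousOn
  refine ⟨q.1, m.2, fun x hx => hqmax hx, fun x hx => abs_le'.2 ⟨hmmax hx, ?_⟩,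
    hE.segment_mem_closure hq (by simp), m.1, hm⟩
  exact hmmax (hE.symmetric_closure hx)

theorem volume_closure_ne_top (hE : IsCrossSection E) : volume (closure E) ≠ ⊤ :=
  hE.isCompact_closure.measure_lt_top.ne

theorem volume_ne_top (hE : IsCrossSection E) : volume E ≠ ⊤ :=
  hE.bounded.measure_lt_top.ne

theorem area_pos (hE : IsCrossSection E) : 0 < area E :=
  ENNReal.toReal_pos ((isOpen_interior.measure_pos volume hE.interior_nonempty).trans_le
    (measure_mono interior_subset)).ne' hE.volume_ne_top

theorem ae_eq_closure (hE : IsCrossSection E) : E =ᵐ[volume] closure E :=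
  (closure_ae_eq_of_null_frontier (hE.convex.addHaar_frontier volume)).symm

theorem ae_eq_interior (hE : IsCrossSection E) : E =ᵐ[volume] interior E :=
  (interior_ae_eq_of_null_frontier (hE.convex.addHaar_frontier volume)).symm

end IsCrossSection

namespace HasExtents

variable {b h : ℝ}

theorem pos_fst (hx : HasExtents E b h) (hE : IsCrossSection E) : 0 < b :=
  hE.closure_subset hx.right_mem

theorem nonneg_snd (hx : HasExtents E b h) : 0 ≤ h :=
  (abs_nonneg _).trans (hx.abs_snd_le _ hx.right_mem)

theorem area_le (hx : HasExtents E b h) (hE : IsCrossSection E) : area E ≤ 2 * b * h := by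
  have hsub : E ⊆ Icc 0 b ×ˢ Icc (-h) h := fun x hxE =>
    ⟨⟨le_of_lt (hE.closure_subset (subset_closure hxE)), hx.fst_le x (subset_closure hxE)⟩,
      abs_le.1 (hx.abs_snd_le x (subset_closure hxE))⟩
  calc area E ≤ volume.real (Icc 0 b ×ˢ Icc (-h) h) :=
        measureReal_mono hsub (isCompact_Icc.prod isCompact_Icc).measure_lt_top.ne
    _ = 2 * b * h := by
        rw [Measure.volume_eq_prod, measureReal_prod_prod,
          Real.volume_real_Icc_of_le (hx.pos_fst hE).le,
          Real.volume_real_Icc_of_le (by linarith [hx.nonneg_snd])]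
        ring

theorem pos_snd (hx : HasExtents E b h) (hE : IsCrossSection E) : 0 < h := by
  have h1 := hx.area_le hE
  have h2 := hE.area_pos
  have h3 := hx.pos_fst hE
  by_contra hcon
  nlinarith

/-- The quarter-area copy of `E` shrunk by one half towards `(b, 0)` lies in `{r ≥ b / 2}`. -/
theorem le_majorRadius (hx : HasExtents E b h) (hE : IsCrossSection E) :
    b / 8 ≤ majorRadius E := by
  have hb := hx.pos_fst hE
  have hA := hE.area_pos
  have hint : IntegrableOn (fun p : ℝ × ℝ => p.1) (closure E) :=
    _root_.continuous_fst.continuousOn.integrableOn_compact hE.isCompact_closure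
  set S : Set (ℝ × ℝ) := AffineMap.homothety ((b, 0) : ℝ × ℝ) (1 / 2 : ℝ) '' interior E with hS
  have hSE : S ⊆ closure E := by
    rintro _ ⟨x, hxE, rfl⟩
    refine interior_subset_closure (hE.convex.openSegment_interior_closure_subset_interior hxE
      hx.right_mem ⟨1 / 2, 1 / 2, by norm_num, by norm_num, by norm_num, ?_⟩)
    rw [AffineMap.homothety_apply, vsub_eq_sub, vadd_eq_add]
    module
  have hSm : MeasurableSet S :=
    ((AffineMap.homothety_isOpenMap _ _ (by norm_num)) _ isOpen_interior).measurableSet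
  have hSvol : volume.real S = area E / 4 := by
    rw [Measure.real, hS, Measure.addHaar_image_homothety, ENNReal.toReal_mul,
      ENNReal.toReal_ofReal (abs_nonneg _), ← measure_congr hE.ae_eq_interior]
    simp [Module.finrank_prod, area, Measure.real]
    ring
  have hSb : ∀ x ∈ S, b / 2 ≤ x.1 := by
    rintro _ ⟨x, hxE, rfl⟩
    have : 0 < x.1 := hE.closure_subset (interior_subset_closure hxE)
    simp [AffineMap.homothety_apply]
    linarith
  have h1 : b / 2 * (area E / 4) ≤ ∫ p in E, p.1 := by
    rw [setIntegral_congr_set hE.ae_eq_closure, ← hSvol]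
    calc b / 2 * volume.real S ≤ ∫ p in S, p.1 :=
          setIntegral_ge_of_const_le_real hSm
            (measure_ne_top_of_subset hSE hE.volume_closure_ne_top) hSb (hint.mono_set hSE)
      _ ≤ ∫ p in closure E, p.1 := by
          refine setIntegral_mono_set hint ?_ hSE.eventuallyLE
          exact (ae_restrict_iff' isClosed_closure.measurableSet).2
            (Eventually.of_forall fun x hxE => le_of_lt (hE.closure_subset hxE))
  unfold majorRadius
  rw [one_div, ← div_eq_inv_mul, le_div_iff₀ hA]
  linarith

/-- Minkowski's formula `L = ∫ κ (c · n) ds` bounds the length of the boundary. -/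
theorem length_le (hx : HasExtents E b h) (hE : IsCrossSection E) (hb : IsBoundaryParam E c L) :
    L ≤ 2 * Real.pi * (b + h) := by
  have hL := hb.length_pos.le
  have cκ := hb.continuous_curvature
  have cκh : Continuous fun s => curvature c s * supportHeight c 0 s :=
    cκ.mul (hb.continuous_supportHeight 0)
  have hd : ∀ s, HasDerivAt (fun s => (c s).1 * (deriv c s).1 + (c s).2 * (deriv c s).2)
      (1 - curvature c s * supportHeight c 0 s) s := by
    intro s
    have := ((hb.hasDerivAt_fst s).mul (hb.hasDerivAt_deriv_fst s)).add
      ((hb.hasDerivAt_snd s).mul (hb.hasDerivAt_deriv_snd s))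
    convert! this using 1
    rw [hb.deriv_deriv_fst, hb.deriv_deriv_snd]
    simp only [supportHeight, Prod.fst_zero, Prod.snd_zero]
    linear_combination -hb.unit_speed s
  have h0 := hb.integral_deriv_eq_zero hd (continuous_const.sub cκh)
    (by simp only [hb.apply_length, hb.deriv_apply_length])
  rw [intervalIntegral.integral_sub (by simp) (cκh.intervalIntegrable _ _)] at h0
  have hle : ∫ s in (0 : ℝ)..L, curvature c s * supportHeight c 0 s
      ≤ ∫ s in (0 : ℝ)..L, curvature c s * (b + h) := by
    refine intervalIntegral.integral_mono_on hL (cκh.intervalIntegrable _ _)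
      ((cκ.mul continuous_const).intervalIntegrable _ _) fun s _ => ?_
    refine mul_le_mul_of_nonneg_left ?_ (hb.curvature_nonneg hE.convex hE.interior_nonempty s)
    have h1 := hx.fst_le _ (hb.mem_closure s)
    have h2 := hx.abs_snd_le _ (hb.mem_closure s)
    have h3 : 0 < (c s).1 := hE.closure_subset (hb.mem_closure s)
    have hu := hb.unit_speed s
    have h4 : |(deriv c s).1| ≤ 1 := abs_le_one_iff_mul_self_le_one.2 (by nlinarith)
    have h5 : |(deriv c s).2| ≤ 1 := abs_le_one_iff_mul_self_le_one.2 (by nlinarith)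
    have h6 : (c s).1 * (deriv c s).2 ≤ b := by nlinarith [le_abs_self (deriv c s).2]
    have h7 : -((c s).2 * (deriv c s).1) ≤ h :=
      (neg_le_abs _).trans (by rw [abs_mul]; nlinarith [abs_nonneg (c s).2])
    simp only [supportHeight, Prod.fst_zero, Prod.snd_zero]
    linarith
  rw [intervalIntegral.integral_mul_const,
    hb.integral_curvature hE.convex hE.bounded hE.interior_nonempty] at hle
  simp only [intervalIntegral.integral_const, sub_zero, smul_eq_mul, mul_one] at h0
  linarith

theorem two_mul_le_integral (hx : HasExtents E b h) (hE : IsCrossSection E)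
    (hb : IsBoundaryParam E c L) : 2 * h ≤ ∫ s in (0 : ℝ)..L, max (deriv c s).2 0 := by
  obtain ⟨m, hm⟩ := hx.exists_top
  -- A point of extremal height is a boundary point.
  have hfr : ∀ z, |z| = h → (m, z) ∈ closure E → ∃ s ∈ Ico 0 L, c s = (m, z) := by
    intro z hz hmz
    change (m, z) ∈ c '' Ico 0 L
    rw [hb.image_eq]
    refine ⟨hmz, fun hint => ?_⟩
    obtain ⟨ε, hε, hball⟩ := Metric.isOpen_iff.1 isOpen_interior _ hint
    have hmem : ∀ w : ℝ, |w - z| < ε → |w| ≤ h := fun w hw =>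
      hx.abs_snd_le (m, w) (interior_subset_closure (hball (by
        rw [Metric.mem_ball, Prod.dist_eq, dist_self, Real.dist_eq]
        exact max_lt hε hw)))
    have h1 := hmem (z + ε / 2) (by rw [add_sub_cancel_left, abs_of_pos] <;> linarith)
    have h2 := hmem (z - ε / 2) (by rw [sub_sub_cancel_left, abs_neg, abs_of_pos] <;> linarith)
    rw [abs_le] at h1 h2
    rcases abs_choice z with h3 | h3 <;> linarith
  have habs := abs_of_nonneg hx.nonneg_snd
  obtain ⟨s₁, hs1, hc1⟩ := hfr (-h) (by rw [abs_neg, habs]) (hE.symmetric_closure hm)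
  obtain ⟨s₂, hs2, hc2⟩ := hfr h habs hm
  obtain ⟨s₃, hs13, hs31, hc3⟩ : ∃ s₃, s₁ ≤ s₃ ∧ s₃ ≤ s₁ + L ∧ c s₃ = (m, h) := by
    rcases le_total s₁ s₂ with h1 | h1
    · exact ⟨s₂, h1, by linarith [hs1.1, hs2.2], hc2⟩
    · exact ⟨s₂ + L, by linarith [hs1.2, hs2.1], by linarith, by rw [hb.periodic s₂, hc2]⟩
  have cm : Continuous fun s => max (deriv c s).2 0 := hb.continuous_deriv_snd.max continuous_const
  have hper : Function.Periodic (fun s => max (deriv c s).2 0) L := fun s => by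
    simp only [hb.periodic_deriv s]
  calc 2 * h = (c s₃).2 - (c s₁).2 := by rw [hc1, hc3]; ring
    _ = ∫ s in s₁..s₃, (deriv c s).2 :=
        (intervalIntegral.integral_eq_sub_of_hasDerivAt (fun s _ => hb.hasDerivAt_snd s)
          (hb.continuous_deriv_snd.intervalIntegrable _ _)).symm
    _ ≤ ∫ s in s₁..s₃, max (deriv c s).2 0 :=
        intervalIntegral.integral_mono_on hs13 (hb.continuous_deriv_snd.intervalIntegrable _ _)
          (cm.intervalIntegrable _ _) fun s _ => le_max_left _ _
    _ ≤ ∫ s in s₁..s₁ + L, max (deriv c s).2 0 :=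
        intervalIntegral.integral_mono_interval le_rfl hs13 hs31
          (Eventually.of_forall fun s => le_max_right _ _) (cm.intervalIntegrable _ _)
    _ = ∫ s in (0 : ℝ)..L, max (deriv c s).2 0 := by
        rw [hper.intervalIntegral_add_eq s₁ 0, zero_add]

end HasExtents

end Size

/-! ### The radial energy of the normal -/

section Energy

variable {E : Set (ℝ × ℝ)} {c : ℝ → ℝ × ℝ} {L : ℝ}

/-- The energy `∫_{∂E} (n · e_r)² / r ds`. -/
def normalEnergy (c : ℝ → ℝ × ℝ) (L : ℝ) : ℝ := ∫ s in (0 : ℝ)..L, (deriv c s).2 ^ 2 / (c s).1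

theorem sq_integral_le_mul_integral {f g : ℝ → ℝ} {M : ℝ} (hL : 0 < L) (hM : 0 < M)
    (hf : Continuous f) (hg : Continuous g) (hfg : ∀ s, f s ^ 2 ≤ M * g s) :
    (∫ s in (0 : ℝ)..L, f s) ^ 2 ≤ M * L * ∫ s in (0 : ℝ)..L, g s := by
  set I := ∫ s in (0 : ℝ)..L, f s
  -- Integrate `2 k f ≤ f² / M + k² M` with the optimal `k`.
  set k := I / (M * L) with hk
  have h1 : ∫ s in (0 : ℝ)..L, (2 * k * f s - k ^ 2 * M) ≤ ∫ s in (0 : ℝ)..L, g s := by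
    refine intervalIntegral.integral_mono_on hL.le
      (Continuous.intervalIntegrable (by fun_prop) _ _) (hg.intervalIntegrable _ _) fun s _ => ?_
    have h2 : f s ^ 2 / M ≤ g s := (div_le_iff₀' hM).2 (hfg s)
    have h3 : 2 * k * f s - k ^ 2 * M = f s ^ 2 / M - (f s - k * M) ^ 2 / M := by
      field_simp
      ring
    have h4 : 0 ≤ (f s - k * M) ^ 2 / M := by positivity
    linarith
  rw [intervalIntegral.integral_sub ((hf.const_mul _).intervalIntegrable _ _) (by simp),
    intervalIntegral.integral_const_mul] at h1
  simp only [intervalIntegral.integral_const, sub_zero, smul_eq_mul] at h1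
  have hML : 0 < M * L := mul_pos hM hL
  have h5 : 2 * k * I - L * (k ^ 2 * M) = I ^ 2 / (M * L) := by
    rw [hk]
    field_simp
    ring
  change 2 * k * I - L * (k ^ 2 * M) ≤ _ at h1
  rwa [h5, div_le_iff₀' hML] at h1

theorem fst_pos (hE : IsCrossSection E) (hb : IsBoundaryParam E c L) (s : ℝ) : 0 < (c s).1 :=
  hE.closure_subset (hb.mem_closure s)

theorem continuous_energyDensity (hE : IsCrossSection E) (hb : IsBoundaryParam E c L) :
    Continuous fun s => (deriv c s).2 ^ 2 / (c s).1 :=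
  (hb.continuous_deriv_snd.pow 2).div hb.continuous_fst fun s => (fst_pos hE hb s).ne'

namespace HasExtents

variable {b h : ℝ}

theorem energy_ge_of_tall (hx : HasExtents E b h) (hE : IsCrossSection E)
    (hb : IsBoundaryParam E c L) : 4 * h ^ 2 ≤ b * L * normalEnergy c L := by
  have hP := hx.two_mul_le_integral hE hb
  have h0 := hx.nonneg_snd
  have key := sq_integral_le_mul_integral hb.length_pos (hx.pos_fst hE)
    (hb.continuous_deriv_snd.max continuous_const) (continuous_energyDensity hE hb)
    (f := fun s => max (deriv c s).2 0) fun s => ?_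
  · refine le_trans ?_ key
    nlinarith
  · have hr := fst_pos hE hb s
    have h1 : max (deriv c s).2 0 ^ 2 ≤ (deriv c s).2 ^ 2 := by
      rcases max_choice (deriv c s).2 0 with h2 | h2 <;> rw [h2]
      simpa using sq_nonneg (deriv c s).2
    refine h1.trans ?_
    calc (deriv c s).2 ^ 2 = (c s).1 * ((deriv c s).2 ^ 2 / (c s).1) := by field_simp
      _ ≤ b * ((deriv c s).2 ^ 2 / (c s).1) := by
        gcongr
        exact hx.fst_le _ (hb.mem_closure s)

/-- If the closure of a flat cross-section contains a point at height `3h/4` within distance `h`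
of the axis, it contains the block `[h, 2h] × [-h/4, h/4]`, so
that the weight `(r + h)⁻²` has integral bounded below. -/
theorem setIntegral_inv_sq_ge (hx : HasExtents E b h) (hE : IsCrossSection E) (hhb : 4 * h ≤ b)
    {r z : ℝ} (hrz : (r, z) ∈ closure E) (hr : r ≤ h) (hz : 3 * h / 4 ≤ |z|) :
    1 / 18 ≤ ∫ x in E, 1 / (x.1 + h) ^ 2 := by
  have hh := hx.pos_snd hE
  have hr0 : 0 < r := hE.closure_subset hrz
  set Q : Set (ℝ × ℝ) := Icc h (2 * h) ×ˢ Icc (-(h / 4)) (h / 4) with hQ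
  have hQE : Q ⊆ closure E := by
    rintro ⟨x, y⟩ ⟨hx1, hy1⟩
    simp only [mem_Icc] at hx1 hy1
    have hbr : 0 < b - r := by linarith
    -- `(x, y)` lies on the segment from `(b, 0)` to a point above `r`.
    set θ := (x - r) / (b - r) with hθ
    have hθ0 : 0 ≤ θ := div_nonneg (by linarith) hbr.le
    have hθ1 : θ ≤ 1 / 2 := by rw [hθ, div_le_iff₀ hbr]; linarith
    have hθx : θ * (b - r) = x - r := div_mul_cancel₀ _ hbr.ne'
    have h1θ : 0 < 1 - θ := by linarith
    have hw : |y / (1 - θ)| ≤ |z| := by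
      rw [abs_div, abs_of_pos h1θ, div_le_iff₀ h1θ]
      have : |y| ≤ h / 4 := abs_le.2 ⟨by linarith, hy1.2⟩
      nlinarith
    have hconv := hE.convex.closure hx.right_mem (hE.segment_mem_closure hrz hw) hθ0 h1θ.le
      (by ring)
    convert hconv using 1
    ext
    · simp; linarith
    · simp; field_simp
  have hint : IntegrableOn (fun x : ℝ × ℝ => 1 / (x.1 + h) ^ 2) (closure E) := by
    refine ContinuousOn.integrableOn_compact hE.isCompact_closure
      (ContinuousOn.div (by fun_prop) (by fun_prop) ?_)
    intro x hxE
    have : 0 < x.1 := hE.closure_subset hxE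
    positivity
  have hQvol : volume.real Q = h * (h / 2) := by
    rw [hQ, Measure.volume_eq_prod, measureReal_prod_prod,
      Real.volume_real_Icc_of_le (by linarith), Real.volume_real_Icc_of_le (by linarith)]
    ring
  rw [setIntegral_congr_set hE.ae_eq_closure]
  calc (1 : ℝ) / 18 = 1 / (9 * h ^ 2) * volume.real Q := by
        rw [hQvol]; field_simp; norm_num
    _ ≤ ∫ x in Q, 1 / (x.1 + h) ^ 2 := by
        refine setIntegral_ge_of_const_le_real (measurableSet_Icc.prod measurableSet_Icc)
          (isCompact_Icc.prod isCompact_Icc).measure_lt_top.ne (fun x hxQ => ?_)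
          (hint.mono_set hQE)
        have h1 := hxQ.1
        simp only [mem_Icc] at h1
        refine one_div_le_one_div_of_le (by nlinarith) ?_
        nlinarith
    _ ≤ ∫ x in closure E, 1 / (x.1 + h) ^ 2 :=
        setIntegral_mono_set hint (Eventually.of_forall fun x => by positivity) hQE.eventuallyLE

/-- A boundary point whose normal points slightly to the left is high up: the tangent line there
is nearly horizontal and passes above the top of the cross-section. -/
theorem abs_snd_ge_of_flat (hx : HasExtents E b h) (hE : IsCrossSection E)
    (hb : IsBoundaryParam E c L) (hhb : 4 * h ≤ b) {s : ℝ} (h1 : (deriv c s).2 < 0)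
    (h2 : -(h / (8 * b)) < (deriv c s).2) : 3 * h / 4 ≤ |(c s).2| := by
  have hh := hx.pos_snd hE
  have hbpos := hx.pos_fst hE
  obtain ⟨m, hm⟩ := hx.exists_top
  have hmb : m ≤ b := hx.fst_le _ hm
  have hr := fst_pos hE hb s
  set τ := h / (8 * b) with hτ
  have hτb : τ * b = h / 8 := by rw [hτ]; field_simp
  have hτ32 : τ ≤ 1 / 32 := by rw [hτ, div_le_iff₀ (by positivity)]; linarith
  have hu := hb.unit_speed s
  have hprod : -(h / 8) ≤ (m - (c s).1) * (deriv c s).2 := by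
    rcases le_total m (c s).1 with h3 | h3
    · nlinarith
    · nlinarith
  have hr' : 1 / 4 ≤ (deriv c s).1 ^ 2 := by nlinarith
  have s1 := hb.support hE.convex hE.interior_nonempty s hm
  have s2 := hb.support hE.convex hE.interior_nonempty s (hE.symmetric_closure hm)
  simp only at s1 s2
  rcases le_total 0 (deriv c s).1 with h3 | h3
  · have h4 : 1 / 2 ≤ (deriv c s).1 := by nlinarith
    -- The outward normal points downwards, so the point is near the bottom.
    have : (c s).2 ≤ -(3 * h / 4) := by nlinarith
    exact le_abs.2 (Or.inr (by linarith))
  · have h4 : (deriv c s).1 ≤ -(1 / 2) := by nlinarith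
    have : 3 * h / 4 ≤ (c s).2 := by nlinarith
    exact le_abs.2 (Or.inl this)

/-- The normal of a thick ring has radial energy at least of order `h / b`. For a flat section,
either the boundary near the axis and to the left is nowhere flat, and then
`-n_r / r ≤ n_r² / (τ r) + τ / h` with `τ = h / (8 b)` can be integrated, or the section contains
a block of size `h` at distance `h` from the axis, and Cauchy–Schwarz against the weight
`(r + h)⁻¹` applies. -/
theorem energy_ge (hx : HasExtents E b h) (hE : IsCrossSection E) (hb : IsBoundaryParam E c L)
    (hthick : 2 * Real.pi ≤ ∫ x in E, 1 / x.1 ^ 2) :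
    h / (1000 * b) ≤ normalEnergy c L := by
  have hh := hx.pos_snd hE
  have hbpos := hx.pos_fst hE
  have hL := hb.length_pos
  have hLle := hx.length_le hE hb
  have hpi := Real.pi_gt_three
  have hpi' := Real.pi_lt_d2
  have cX := continuous_energyDensity hE hb
  rcases lt_or_ge b (4 * h) with hcase | hcase
  · have h1 := hx.energy_ge_of_tall hE hb
    have hL32 : L ≤ 32 * h := by nlinarith
    have hX : 0 ≤ normalEnergy c L := by
      by_contra hneg
      push Not at hneg
      nlinarith [mul_pos hbpos hL]
    have h2 : b * L * normalEnergy c L ≤ b * (32 * h) * normalEnergy c L := by gcongr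
    have h3 : h ≤ normalEnergy c L * (8 * b) := by
      refine le_of_mul_le_mul_left ?_ (by positivity : 0 < 4 * h)
      linarith
    rw [div_le_iff₀ (by positivity)]
    have : 0 ≤ normalEnergy c L * b := by positivity
    linarith
  · set τ := h / (8 * b) with hτ
    have hτpos : 0 < τ := by positivity
    have hτb : τ * b = h / 8 := by rw [hτ]; field_simp
    have hL8 : L ≤ 8 * b := by nlinarith
    by_cases hflat : ∃ s, (deriv c s).2 < 0 ∧ -τ < (deriv c s).2 ∧ (c s).1 ≤ h
    · obtain ⟨s, hs1, hs2, hs3⟩ := hflat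
      have hJ := hx.setIntegral_inv_sq_ge hE hcase (hb.mem_closure s) hs3
        (hx.abs_snd_ge_of_flat hE hb hcase hs1 hs2)
      rw [hb.setIntegral_inv_sq hE hh.le] at hJ
      have hpos : ∀ s, 0 < (c s).1 + h := fun s => by linarith [fst_pos hE hb s]
      have cf : Continuous fun s => (deriv c s).2 / ((c s).1 + h) :=
        hb.continuous_deriv_snd.div (hb.continuous_fst.add continuous_const) fun s => (hpos s).ne'
      have key := sq_integral_le_mul_integral hL (by positivity : 0 < 1 / (4 * h)) cf cX
        fun s => by
          have hr := fst_pos hE hb s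
          have h1 := hpos s
          rw [div_pow, div_mul_div_comm, one_mul]
          refine div_le_div_of_nonneg_left (sq_nonneg _) (by positivity) ?_
          nlinarith [sq_nonneg ((c s).1 - h)]
      have hX : normalEnergy c L = ∫ s in (0 : ℝ)..L, (deriv c s).2 ^ 2 / (c s).1 := rfl
      rw [← hX] at key
      set I := ∫ s in (0 : ℝ)..L, (deriv c s).2 / ((c s).1 + h)
      have hI : (1 / 18 : ℝ) ^ 2 ≤ I ^ 2 := by nlinarith
      have hkey : h * (4 * (1 / 18 : ℝ) ^ 2) ≤ L * normalEnergy c L := by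
        have h1 := hI.trans key
        have h2 : 1 / (4 * h) * L * normalEnergy c L = L * normalEnergy c L / (4 * h) := by
          field_simp
        rw [h2, le_div_iff₀ (by positivity)] at h1
        linarith
      have hX0 : 0 ≤ normalEnergy c L := by
        by_contra hneg
        push Not at hneg
        nlinarith
      have : L * normalEnergy c L ≤ 8 * b * normalEnergy c L := by gcongr
      rw [div_le_iff₀ (by positivity)]
      nlinarith
    · push Not at hflat
      have h0 := hb.setIntegral_inv_sq hE le_rfl
      simp only [add_zero] at h0
      rw [h0, ← intervalIntegral.integral_neg] at hthick
      have cf : Continuous fun s => (deriv c s).2 / (c s).1 :=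
        hb.continuous_deriv_snd.div hb.continuous_fst fun s => (fst_pos hE hb s).ne'
      have hmono : ∫ s in (0 : ℝ)..L, -((deriv c s).2 / (c s).1)
          ≤ ∫ s in (0 : ℝ)..L, (1 / τ * ((deriv c s).2 ^ 2 / (c s).1) + τ / h) := by
        refine intervalIntegral.integral_mono_on hL.le (cf.neg.intervalIntegrable _ _)
          (((cX.const_mul _).add continuous_const).intervalIntegrable _ _) fun s _ => ?_
        have hr := fst_pos hE hb s
        have hnn : 0 ≤ 1 / τ * ((deriv c s).2 ^ 2 / (c s).1) := by positivity
        have hnn' : 0 < τ / h := by positivity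
        rw [← neg_div]
        rcases le_or_gt 0 (deriv c s).2 with h1 | h1
        · have : -(deriv c s).2 / (c s).1 ≤ 0 := div_nonpos_of_nonpos_of_nonneg (by linarith) hr.le
          linarith
        rcases le_or_gt (deriv c s).2 (-τ) with h2 | h2
        · have : -(deriv c s).2 / (c s).1 ≤ 1 / τ * ((deriv c s).2 ^ 2 / (c s).1) := by
            rw [← mul_div_assoc]
            gcongr
            rw [one_div, inv_mul_eq_div, le_div_iff₀ hτpos]
            nlinarith
          linarith
        · have : -(deriv c s).2 / (c s).1 ≤ τ / h := by
            have := hflat s h1 h2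
            gcongr
            linarith
          linarith
      rw [intervalIntegral.integral_add ((cX.const_mul _).intervalIntegrable _ _) (by simp),
        intervalIntegral.integral_const_mul] at hmono
      simp only [intervalIntegral.integral_const, sub_zero, smul_eq_mul] at hmono
      change _ ≤ 1 / τ * normalEnergy c L + L * (τ / h) at hmono
      have h1 : L * (τ / h) ≤ 1 := by
        rw [← mul_div_assoc, div_le_one hh]
        nlinarith
      have h2 : τ ≤ normalEnergy c L := by
        have h3 : 1 ≤ 1 / τ * normalEnergy c L := by linarith
        rwa [one_div, inv_mul_eq_div, le_div_iff₀ hτpos, one_mul] at h3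
      refine le_trans ?_ h2
      rw [hτ]
      gcongr
      norm_num

end HasExtents

end Energy

/-! ### The Bernoulli condition and the circulation -/

section Flow

variable {σ ρ : ℝ} {E : Set (ℝ × ℝ)} {c : ℝ → ℝ × ℝ} {L : ℝ} {ψ : ℝ × ℝ → ℝ} {W flux lam : ℝ}

theorem continuous_meanCurvature (hE : IsCrossSection E) (hb : IsBoundaryParam E c L) :
    Continuous (meanCurvature c) :=
  hb.continuous_curvature.add
    (hb.continuous_deriv_snd.div hb.continuous_fst fun s => (fst_pos hE hb s).ne')

theorem boundaryIntegral_meanCurvature (hE : IsCrossSection E) (hb : IsBoundaryParam E c L) :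
    boundaryIntegral L (meanCurvature c) = -thickness E := by
  have cf : Continuous fun s => (deriv c s).2 / (c s).1 :=
    hb.continuous_deriv_snd.div hb.continuous_fst fun s => (fst_pos hE hb s).ne'
  have h0 := hb.setIntegral_inv_sq hE le_rfl
  simp only [add_zero] at h0
  have h1 : boundaryIntegral L (meanCurvature c)
      = ∫ s in (0 : ℝ)..L, (curvature c s + (deriv c s).2 / (c s).1) := rfl
  rw [h1, intervalIntegral.integral_add (hb.continuous_curvature.intervalIntegrable _ _)
    (cf.intervalIntegrable _ _),
    hb.integral_curvature hE.convex hE.bounded hE.interior_nonempty, thickness, h0]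
  ring

/-- The translation identity `∫ H n_r ds = ∫ n_r² / r ds`: the curvature of a closed plane curve
exerts no net force. -/
theorem integral_meanCurvature_mul (hE : IsCrossSection E) (hb : IsBoundaryParam E c L) :
    ∫ s in (0 : ℝ)..L, meanCurvature c s * (deriv c s).2 = normalEnergy c L := by
  have h0 := hb.integral_deriv_eq_zero hb.hasDerivAt_deriv_fst hb.continuous_deriv_deriv.fst
    (by simp only [hb.deriv_apply_length])
  have h1 : ∀ s, meanCurvature c s * (deriv c s).2
      = (deriv c s).2 ^ 2 / (c s).1 - (deriv (deriv c) s).1 := fun s => by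
    rw [hb.deriv_deriv_fst]
    simp only [meanCurvature, normal]
    ring
  simp only [h1]
  rw [intervalIntegral.integral_sub ((continuous_energyDensity hE hb).intervalIntegrable _ _)
    (hb.continuous_deriv_deriv.fst.intervalIntegrable _ _), h0, sub_zero, normalEnergy]

namespace IsSolution

theorem normalDeriv_movingStream (hs : IsSolution σ ρ E c L ψ W flux lam) (s : ℝ) :
    normalDeriv c (movingStream ψ W) s
      = normalDeriv c ψ s - W * (c s).1 * (normal c s).1 := by
  have hb := hs.boundary
  have hE := hs.crossSection
  set n := normal c s with hn
  set ray : ℝ → ℝ × ℝ := fun t => c s + t • n with hray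
  have cray : Continuous ray := by fun_prop
  have hray0 : ray 0 = c s := by simp [hray]
  -- The normal ray stays in the fluid domain for short times.
  have hout : ∀ t : ℝ, 0 ≤ t → ray t ∉ interior E := by
    intro t ht hmem
    have h1 := hb.support_interior hE.convex hE.interior_nonempty s hmem
    simp only [hray, hn, normal, Prod.fst_add, Prod.snd_add, Prod.smul_fst, Prod.smul_snd,
      smul_eq_mul, add_sub_cancel_left] at h1
    nlinarith [hb.unit_speed s]
  have hopen : IsOpen halfPlane := isOpen_lt continuous_const _root_.continuous_fst
  have hdom : ray ⁻¹' (halfPlane \ interior E) ∈ 𝓝[≥] (0 : ℝ) := by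
    have h1 : ∀ᶠ t in 𝓝 (0 : ℝ), ray t ∈ halfPlane :=
      cray.continuousAt.eventually (hopen.mem_nhds (by rw [hray0]; exact fst_pos hE hb s))
    filter_upwards [h1.filter_mono nhdsWithin_le_nhds, self_mem_nhdsWithin] with t ht ht0
    exact ⟨ht, hout t ht0⟩
  have hψ : DifferentiableWithinAt ℝ ψ (halfPlane \ interior E) (ray 0) := by
    rw [hray0]
    exact hs.contDiffOn_boundary.differentiableOn (by norm_num) _
      ⟨fst_pos hE hb s, hb.notMem_interior s⟩
  have hrayd : HasDerivAt ray n 0 := by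
    convert! ((hasDerivAt_id (0 : ℝ)).smul_const n).const_add (c s) using 1
    rw [one_smul]
  have hcomp : DifferentiableWithinAt ℝ (fun t => ψ (ray t)) (Ici 0) 0 := by
    refine DifferentiableWithinAt.mono_of_mem_nhdsWithin
      (s := ray ⁻¹' (halfPlane \ interior E)) ?_ hdom
    exact hψ.comp 0 hrayd.differentiableAt.differentiableWithinAt (mapsTo_preimage _ _)
  have hsq : HasDerivAt (fun t => W * (ray t).1 ^ 2 / 2) (W * (c s).1 * n.1) 0 := by
    have h1 : HasDerivAt (fun t => (ray t).1) n.1 0 :=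
      (ContinuousLinearMap.fst ℝ ℝ ℝ).hasFDerivAt.comp_hasDerivAt 0 hrayd
    have h2 := ((h1.pow 2).const_mul W).div_const 2
    convert! h2 using 1
    rw [hray0]
    norm_num
    ring
  exact (hcomp.hasDerivWithinAt.sub hsq.hasDerivWithinAt).derivWithin
    (uniqueDiffOn_Ici 0 0 self_mem_Ici)

/-- The relative velocity `(1/r) ∂_n Ψ`, expressed through the Bernoulli condition; its sign comes
from `∂_n Ψ ≤ 0`. -/
theorem relative_speed_eq (hs : IsSolution σ ρ E c L ψ W flux lam) (hρ : 0 < ρ)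
    (hmax : ∀ s, normalDeriv c (movingStream ψ W) s ≤ 0) (s : ℝ) :
    0 ≤ 2 * σ * meanCurvature c s + lam ∧
    1 / (c s).1 * normalDeriv c ψ s
      = W * (deriv c s).2 - √((2 * σ * meanCurvature c s + lam) / ρ) := by
  have hr := fst_pos hs.crossSection hs.boundary s
  have h1 := hmax s
  rw [hs.normalDeriv_movingStream] at h1
  have h2 := hs.bernoulli s
  have hg : 1 / (c s).1 * normalDeriv c ψ s - W * (normal c s).1 ≤ 0 := by
    have : 1 / (c s).1 * normalDeriv c ψ s - W * (normal c s).1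
        = (normalDeriv c ψ s - W * (c s).1 * (normal c s).1) / (c s).1 := by field_simp
    rw [this]
    exact div_nonpos_of_nonpos_of_nonneg h1 hr.le
  set g := 1 / (c s).1 * normalDeriv c ψ s - W * (normal c s).1 with hgdef
  have h3 : 2 * σ * meanCurvature c s + lam = ρ * g ^ 2 := by linarith
  have hn : (normal c s).1 = (deriv c s).2 := rfl
  refine ⟨by rw [h3]; positivity, ?_⟩
  rw [h3, mul_div_cancel_left₀ _ hρ.ne', Real.sqrt_sq_eq_abs, abs_of_nonpos hg, hgdef, hn]
  ring

theorem circulation_eq (hs : IsSolution σ ρ E c L ψ W flux lam) (hρ : 0 < ρ)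
    (hmax : ∀ s, normalDeriv c (movingStream ψ W) s ≤ 0) :
    circulation c L ψ = ∫ s in (0 : ℝ)..L, √((2 * σ * meanCurvature c s + lam) / ρ) := by
  have hb := hs.boundary
  have cH := continuous_meanCurvature hs.crossSection hb
  have h0 := hb.integral_deriv_eq_zero hb.hasDerivAt_snd hb.continuous_deriv_snd
    (by simp only [hb.apply_length])
  unfold circulation boundaryIntegral
  simp only [fun s => (hs.relative_speed_eq hρ hmax s).2]
  rw [intervalIntegral.integral_sub
    ((hb.continuous_deriv_snd.const_mul W).intervalIntegrable _ _)
    (Continuous.intervalIntegrable (by fun_prop) _ _), intervalIntegral.integral_const_mul, h0]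
  ring

/-- Lower bound for the Bernoulli constant. With the squared speed `q = 2 σ H + λ ≥ 0` one has
`∫ q n_r ds ≤ ∫ q ds`, where `∫ q n_r ds = 2 σ ∫ n_r² / r ds` and `∫ q ds = λ L - 2 σ δ`. -/
theorem mul_length_ge (hs : IsSolution σ ρ E c L ψ W flux lam) (hρ : 0 < ρ)
    (hmax : ∀ s, normalDeriv c (movingStream ψ W) s ≤ 0) :
    2 * σ * (normalEnergy c L + thickness E) ≤ lam * L := by
  have hb := hs.boundary
  have hE := hs.crossSection
  have cH := continuous_meanCurvature hE hb
  have cz := hb.continuous_deriv_snd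
  have h0 := hb.integral_deriv_eq_zero hb.hasDerivAt_snd cz (by simp only [hb.apply_length])
  have hle : ∫ s in (0 : ℝ)..L,
        (2 * σ * (meanCurvature c s * (deriv c s).2) + lam * (deriv c s).2)
      ≤ ∫ s in (0 : ℝ)..L, (2 * σ * meanCurvature c s + lam) := by
    refine intervalIntegral.integral_mono_on hb.length_pos.le
      (Continuous.intervalIntegrable (by fun_prop) _ _)
      (Continuous.intervalIntegrable (by fun_prop) _ _) fun s _ => ?_
    have h1 := (hs.relative_speed_eq hρ hmax s).1
    have h2 : (deriv c s).2 ≤ 1 := by nlinarith [hb.unit_speed s, sq_nonneg (deriv c s).1]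
    nlinarith
  rw [intervalIntegral.integral_add (Continuous.intervalIntegrable (by fun_prop) _ _)
      (Continuous.intervalIntegrable (by fun_prop) _ _),
    intervalIntegral.integral_add (Continuous.intervalIntegrable (by fun_prop) _ _) (by simp),
    intervalIntegral.integral_const_mul, intervalIntegral.integral_const_mul,
    intervalIntegral.integral_const_mul, integral_meanCurvature_mul hE hb, h0] at hle
  have h1 := boundaryIntegral_meanCurvature hE hb
  unfold boundaryIntegral at h1
  rw [h1] at hle
  simp only [intervalIntegral.integral_const, sub_zero, smul_eq_mul] at hle
  linarith

/-- With `Ψ_n ≤ 0`, no cancellation occurs in the circulation, and its outer part alone, where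
`n_r ≥ 0` and hence `H ≥ 0`, gives the lower bound. -/
theorem circulation_ge (hs : IsSolution σ ρ E c L ψ W flux lam) (hσ : 0 < σ) (hρ : 0 < ρ)
    (hmax : ∀ s, normalDeriv c (movingStream ψ W) s ≤ 0) {b h : ℝ} (hx : HasExtents E b h) :
    √(lam / ρ) * (2 * h) ≤ circulation c L ψ := by
  have hb := hs.boundary
  have hE := hs.crossSection
  have cH := continuous_meanCurvature hE hb
  have cm : Continuous fun s => max (deriv c s).2 0 := hb.continuous_deriv_snd.max continuous_const
  rw [hs.circulation_eq hρ hmax]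
  calc √(lam / ρ) * (2 * h) ≤ √(lam / ρ) * ∫ s in (0 : ℝ)..L, max (deriv c s).2 0 := by
        gcongr
        exact hx.two_mul_le_integral hE hb
    _ = ∫ s in (0 : ℝ)..L, √(lam / ρ) * max (deriv c s).2 0 :=
        (intervalIntegral.integral_const_mul _ _).symm
    _ ≤ _ := by
        refine intervalIntegral.integral_mono_on hb.length_pos.le
          ((cm.const_mul _).intervalIntegrable _ _)
          (Continuous.intervalIntegrable (by fun_prop) _ _) fun s _ => ?_
        rcases le_total (deriv c s).2 0 with h1 | h1
        · rw [max_eq_right h1, mul_zero]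
          exact Real.sqrt_nonneg _
        · -- On the outer part of the boundary `H ≥ 0`, so the speed is at least `√(λ / ρ)`.
          rw [max_eq_left h1]
          have h2 : (deriv c s).2 ≤ 1 := by nlinarith [hb.unit_speed s, sq_nonneg (deriv c s).1]
          have hH : 0 ≤ meanCurvature c s :=
            add_nonneg (hb.curvature_nonneg hE.convex hE.interior_nonempty s)
              (div_nonneg h1 (fst_pos hE hb s).le)
          calc √(lam / ρ) * (deriv c s).2 ≤ √(lam / ρ) * 1 := by gcongr
            _ ≤ √((2 * σ * meanCurvature c s + lam) / ρ) := by
                rw [mul_one]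
                gcongr
                linarith [mul_nonneg (mul_nonneg zero_le_two hσ.le) hH]

theorem weber_ge (hs : IsSolution σ ρ E c L ψ W flux lam) (hσ : 0 < σ) (hρ : 0 < ρ)
    (hthick : 0 ≤ thickness E)
    (hmax : ∀ s, normalDeriv c (movingStream ψ W) s ≤ 0) {b h : ℝ} (hx : HasExtents E b h) :
    8 * h ^ 2 * (normalEnergy c L + thickness E) / (L * √(area E)) ≤ weber σ ρ E c L ψ := by
  have hL := hs.boundary.length_pos
  have hE := hs.crossSection
  have hh := hx.pos_snd hE
  have hq : 0 < √(area E) := Real.sqrt_pos.2 hE.area_pos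
  have hX : 0 ≤ normalEnergy c L :=
    intervalIntegral.integral_nonneg hL.le fun s _ =>
      div_nonneg (sq_nonneg _) (fst_pos hE hs.boundary s).le
  have hlam := hs.mul_length_ge hρ hmax
  have hlam0 : 0 ≤ lam := by
    have h1 : 0 ≤ lam * L := le_trans (by positivity) hlam
    exact nonneg_of_mul_nonneg_left h1 hL
  have hβ := pow_le_pow_left₀ (by positivity) (hs.circulation_ge hσ hρ hmax hx) 2
  rw [mul_pow, Real.sq_sqrt (by positivity)] at hβ
  have hβ' : 4 * h ^ 2 * lam ≤ ρ * circulation c L ψ ^ 2 := by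
    have h1 := mul_le_mul_of_nonneg_left hβ hρ.le
    have h2 : ρ * (lam / ρ * (2 * h) ^ 2) = 4 * h ^ 2 * lam := by field_simp; ring
    rwa [h2] at h1
  have hpi : 1 ≤ √(2 * Real.pi) := Real.one_le_sqrt.2 (by linarith [Real.pi_gt_three])
  unfold weber
  rw [div_le_div_iff₀ (by positivity) (by positivity)]
  have h3 : 8 * h ^ 2 * (normalEnergy c L + thickness E) * σ
      ≤ √(2 * Real.pi) * ρ * circulation c L ψ ^ 2 * L := by
    calc 8 * h ^ 2 * (normalEnergy c L + thickness E) * σ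
        = 4 * h ^ 2 * (2 * σ * (normalEnergy c L + thickness E)) := by ring
      _ ≤ 4 * h ^ 2 * (lam * L) := by gcongr
      _ = 4 * h ^ 2 * lam * L := by ring
      _ ≤ ρ * circulation c L ψ ^ 2 * L := by gcongr
      _ = 1 * (ρ * circulation c L ψ ^ 2 * L) := by ring
      _ ≤ √(2 * Real.pi) * (ρ * circulation c L ψ ^ 2 * L) := by gcongr
      _ = √(2 * Real.pi) * ρ * circulation c L ψ ^ 2 * L := by ring
  calc 8 * h ^ 2 * (normalEnergy c L + thickness E) * (σ * √(area E))
      = 8 * h ^ 2 * (normalEnergy c L + thickness E) * σ * √(area E) := by ring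
    _ ≤ √(2 * Real.pi) * ρ * circulation c L ψ ^ 2 * L * √(area E) := by gcongr
    _ = √(2 * Real.pi) * ρ * circulation c L ψ ^ 2 * (L * √(area E)) := by ring

end IsSolution

/-! ### Comparison with the aspect ratio -/

theorem HasExtents.aspect_bound {b h : ℝ} (hx : HasExtents E b h) (hE : IsCrossSection E)
    (hb : IsBoundaryParam E c L) :
    L * √(area E) ≤ 16384 * h ^ 2 * (aspect E + aspect E ^ 3) := by
  have hbpos := hx.pos_fst hE
  have hh := hx.pos_snd hE
  have hA := hx.area_le hE
  have hR := hx.le_majorRadius hE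
  have hLle := hx.length_le hE hb
  have hpi' := Real.pi_lt_d2
  have hq : 0 < √(area E) := Real.sqrt_pos.2 hE.area_pos
  have hqA : √(area E) ^ 2 = area E := Real.sq_sqrt hE.area_pos.le
  set q := √(area E)
  set R := majorRadius E with hRdef
  have hRpos : 0 < R := by linarith
  have hL8 : L ≤ 8 * (b + h) := by nlinarith
  have h1 : aspect E + aspect E ^ 3 = (R * q ^ 2 + R ^ 3) / q ^ 3 := by
    change R / q + (R / q) ^ 3 = _
    field_simp
  rw [h1, ← mul_div_assoc, le_div_iff₀ (by positivity)]
  rw [← hqA] at hA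
  have hbR : b ≤ 8 * R := by linarith
  have h2 : b * q ^ 4 ≤ 2048 * h ^ 2 * R ^ 3 := by
    calc b * q ^ 4 = b * (q ^ 2) ^ 2 := by ring
      _ ≤ b * (2 * b * h) ^ 2 := by gcongr
      _ = 4 * h ^ 2 * b ^ 3 := by ring
      _ ≤ 4 * h ^ 2 * (8 * R) ^ 3 := by gcongr
      _ = 2048 * h ^ 2 * R ^ 3 := by ring
  have h3 : h * q ^ 4 ≤ 16 * h ^ 2 * (R * q ^ 2) := by
    calc h * q ^ 4 = h * q ^ 2 * q ^ 2 := by ring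
      _ ≤ h * q ^ 2 * (2 * (8 * R) * h) := by
          gcongr
          exact hA.trans (by gcongr)
      _ = 16 * h ^ 2 * (R * q ^ 2) := by ring
  have h4 : 0 ≤ h ^ 2 * (R * q ^ 2) := by positivity
  calc L * q * q ^ 3 = L * q ^ 4 := by ring
    _ ≤ 8 * (b + h) * q ^ 4 := by gcongr
    _ = 8 * (b * q ^ 4) + 8 * (h * q ^ 4) := by ring
    _ ≤ 16384 * h ^ 2 * (R * q ^ 2 + R ^ 3) := by linarith

theorem HasExtents.inv_aspect_sq_le {b h : ℝ} (hx : HasExtents E b h) (hE : IsCrossSection E) :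
    1 / aspect E ^ 2 ≤ 128 * h / b := by
  have hbpos := hx.pos_fst hE
  have hh := hx.pos_snd hE
  have hA := hx.area_le hE
  have hR := hx.le_majorRadius hE
  have hRpos : 0 < majorRadius E := by linarith
  rw [aspect, div_pow, Real.sq_sqrt hE.area_pos.le, one_div_div]
  calc area E / majorRadius E ^ 2 ≤ 2 * b * h / (b / 8) ^ 2 := by gcongr
    _ = 128 * h / b := by field_simp; norm_num

end Flow
end BubbleRing

end

theorem theorem1 :
    ∃ C : ℝ, 0 < C ∧
      ∀ (σ ρ : ℝ) (E : Set (ℝ × ℝ)) (c : ℝ → ℝ × ℝ) (L : ℝ) (ψ : ℝ × ℝ → ℝ) (W flux lam : ℝ),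
        0 < σ → 0 < ρ →
        BubbleRing.IsSolution σ ρ E c L ψ W flux lam →
        BubbleRing.boundaryIntegral L (BubbleRing.meanCurvature c) ≤ 0 →
        (∀ s, BubbleRing.normalDeriv c (BubbleRing.movingStream ψ W) s ≤ 0) →
        BubbleRing.weber σ ρ E c L ψ ≥
          C / (BubbleRing.aspect E + BubbleRing.aspect E ^ 3) *
            (1 / BubbleRing.aspect E ^ 2 + BubbleRing.thickness E) := by
  -- `1 / μ² + δ ≤ 128000 (X + δ)` for the normal energy `X`, and
  -- `L √|E| ≤ 16384 h² (μ + μ³)`, to be compared with `8 h² (X + δ) / (L √|E|) ≤ We`.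
  refine ⟨8 / (16384 * 128000), by norm_num, ?_⟩
  intro σ ρ E c L ψ W flux lam hσ hρ hs hH hmax
  have hE := hs.crossSection
  have hb := hs.boundary
  obtain ⟨b, h, hx⟩ := hE.exists_hasExtents
  have hbpos := hx.pos_fst hE
  have hh := hx.pos_snd hE
  have hL := hb.length_pos
  rw [BubbleRing.boundaryIntegral_meanCurvature hE hb] at hH
  have hδ : 0 ≤ BubbleRing.thickness E := by linarith
  have hX := hx.energy_ge hE hb (by unfold BubbleRing.thickness at hδ; linarith)
  have hX0 : 0 < BubbleRing.normalEnergy c L := lt_of_lt_of_le (by positivity) hX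
  have hq : 0 < √(BubbleRing.area E) := Real.sqrt_pos.2 hE.area_pos
  have hμ : 0 < BubbleRing.aspect E :=
    div_pos (by linarith [hx.le_majorRadius hE]) hq
  have h1 := hx.aspect_bound hE hb
  have h2 : 1 / BubbleRing.aspect E ^ 2 ≤ 128000 * BubbleRing.normalEnergy c L := by
    refine (hx.inv_aspect_sq_le hE).trans ?_
    have h3 : 128 * h / b = 128000 * (h / (1000 * b)) := by field_simp; norm_num
    rw [h3]
    gcongr
  refine ge_iff_le.2 (le_trans ?_ (hs.weber_ge hσ hρ hδ hmax hx))
  set μ := BubbleRing.aspect E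
  set X := BubbleRing.normalEnergy c L
  set δ := BubbleRing.thickness E
  set q := √(BubbleRing.area E)
  have h4 : 1 / μ ^ 2 + δ ≤ 128000 * (X + δ) := by linarith
  calc 8 / (16384 * 128000) / (μ + μ ^ 3) * (1 / μ ^ 2 + δ)
      ≤ 8 / (16384 * 128000) / (μ + μ ^ 3) * (128000 * (X + δ)) := by gcongr
    _ = 8 * h ^ 2 * (X + δ) / (16384 * h ^ 2 * (μ + μ ^ 3)) := by field_simp
    _ ≤ 8 * h ^ 2 * (X + δ) / (L * q) := by gcongr
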